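/- **Setting.** Let $n\ge 1$. A clustering of $\{1,\dots,n\}$ into $K$ communities is a surjective map $c:\{1,\dots,n\}\to\{1,\dots,K\}$; write $\mathcal N_k=c^{-1}(k)$, $n_k=|\mathcal N_k|\ge 1$. For an $n\times n$ matrix $B$ let $B^{(k,l)}$ be its block with rows in $\mathcal N_k$ and columns in $\mathcal N_l$. For $J\subseteq\{1,\dots,n\}\times\{1,\dots,K\}$ put $J_{k,l}=\{i\in\mathcal N_k:(i,l)\in J\}$, so that $|J|=\sum_{k,l}|J_{k,l}|$. *Model.* Let $c_*$ be a clustering into $K_*$ communities and $\Lambda_*\in[0,1]^{n\times K_*}$. Let $(P_*)_{i,j}=(\Lambda_*)_{i,c_*(j)}(\Lambda_*)_{j,c_*(i)}$ (so each block $P_*^{(k,l)}=\Lambda_*^{(k,l)}[\Lambda_*^{(l,k)}]^T$ has rank at most one), and $J_*=\{(i,l):(\Lambda_*)_{i,l}\ne 0\}$. The random matrix $A\in\{0,1\}^{n\times n}$ is symmetric and $A_{i,j}$, $1\le i\le j\le n$, are independent Bernoulli variables with means $(P_*)_{i,j}$. *Penalties.* With the convention $0\ln(\cdot/0)=0$,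 for $\beta_1,\beta_2>0$ let $$\mathrm{Pen}^{(s)}(n,J,K)=\beta_1\sum_{k,l=1}^K|J_{k,l}|\ln\frac{n_ke}{|J_{k,l}|}+\beta_2K\sum_{k=1}^K\ln n_k+\beta_2[n\ln K+\ln n],$$ $$\mathrm{Pen}^{(ns)}(n,J,K)=\beta_1|J|\ln\frac{nKe}{|J|}+2\beta_2\ln n+\beta_2[n\ln K+\ln n].$$ *Estimator.* Let $\mathrm{Pen}$ be either of the two penalties, and let $(\hat\Theta,\hat c,\hat J,\hat K)$ minimize $$\sum_{k,l=1}^K\|A^{(k,l)}-\Theta^{(k,l)}\|_F^2+\mathrm{Pen}(n,J,K)$$ over all $K$, all clusterings $c$ into $K$ communities, all $J\subseteq\{1,\dots,n\}\times\{1,\dots,K\}$ and all block matrices $\Theta$ with $\mathrm{supp}(\Theta^{(k,l)})=J_{k,l}\times J_{l,k}$ and $\mathrm{rank}(\Theta^{(k,l)})\le 1$ (i.e. rank one unless the support is empty). Let $\hat P$ be $\hat\Theta$ with rows and columns put back in the original order of the nodes. **Theorem.** There are absolute constants $C_1,C_2>0$ such that the following holds for all $\alpha_1,\alpha_2>0$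 with $\alpha_1+8\alpha_2<1$. Put $$\beta_1=\frac{2(C_1+C_2)(1+\alpha_2)}{\alpha_2}+\frac2{\alpha_1},\quad \beta_2=\frac{2C_2(1+\alpha_2)}{\alpha_2}+\frac2{\alpha_1},\quad H_0=\frac1{1-\alpha_1-8\alpha_2},\quad \tilde C=2H_0\Big(C_2+\frac1{\alpha_1}+\frac{C_2}{\alpha_2}\Big).$$ 1. For either penalty, every $n$, every model as above and every such estimator $\hat P$, for every $t>0$, $$\mathbb P\Big\{n^{-2}\|\hat P-P_*\|_F^2\le n^{-2}H_0\,\mathrm{Pen}(n,J_*,K_*)+n^{-2}\tilde C\,t\Big\}\ge 1-3e^{-t},$$ and $\|\hat P-P_*\|_F^2$ is integrable with $$n^{-2}\,\mathbb E\|\hat P-P_*\|_F^2\le n^{-2}H_0\,\mathrm{Pen}(n,J_*,K_*)+3n^{-2}\tilde C.$$ 2. There is $\kappa>0$, depending only on $C_1,C_2,\alpha_1,\alpha_2$, such that for all $n\ge1$, all clusterings into $K$ communities and all $J$, with $R(n,J,K)=n\ln K+|J|\ln(nKe/|J|)+\ln n$, $$\kappa^{-1}R(n,J,K)\le\mathrm{Pen}^{(ns)}(n,J,K)\le\kappa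 R(n,J,K),$$ and $\mathrm{Pen}^{(s)}(n,J,K)\le\kappa R(n,J,K)$ if moreover $n\ge 8$ and $K\le\sqrt{n/\ln n}$. -/

import Mathlib

open MeasureTheory ProbabilityTheory

namespace SPABM

noncomputable section

/-! ### Community assignments, rearranged matrices and blocks

A clustering of `n` nodes into `K` communities is a map `c : Fin n → Fin K` (the membership matrix
has `Z i k = 1` iff `c i = k`); surjectivity of `c` says that no community is empty. -/

/-- The nodes of community `k`. -/
abbrev Community {n K : ℕ} (c : Fin n → Fin K) (k : Fin K) : Type := {i : Fin n // c i = k}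

/-- The size `n_k` of community `k`. -/
def commSize {n K : ℕ} (c : Fin n → Fin K) (k : Fin K) : ℕ := Fintype.card (Community c k)

/-- Node positions listed community after community. -/
abbrev Rearranged {n K : ℕ} (c : Fin n → Fin K) : Type := Σ k : Fin K, Community c k

/-- The permutation that matches the rearranged positions with the original nodes. -/
def perm {n K : ℕ} (c : Fin n → Fin K) : Rearranged c ≃ Fin n := Equiv.sigmaFiberEquiv c

/-- The rearranged version `B(Z,K)` of `B`. -/
def rearrange {n K : ℕ} (c : Fin n → Fin K) (B : Matrix (Fin n) (Fin n) ℝ) :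
    Matrix (Rearranged c) (Rearranged c) ℝ :=
  B.submatrix (perm c) (perm c)

/-- The inverse of `rearrange`: back to the original order of the nodes. -/
def restore {n K : ℕ} (c : Fin n → Fin K) (M : Matrix (Rearranged c) (Rearranged c) ℝ) :
    Matrix (Fin n) (Fin n) ℝ :=
  M.submatrix (perm c).symm (perm c).symm

/-- The `(k,l)`-th block of a rearranged matrix. -/
def block {n K : ℕ} {c : Fin n → Fin K} (M : Matrix (Rearranged c) (Rearranged c) ℝ)
    (k l : Fin K) : Matrix (Community c k) (Community c l) ℝ :=
  M.submatrix (Sigma.mk k) (Sigma.mk l)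

/-- The squared Frobenius norm. -/
def frobSq {m m' : Type} [Fintype m] [Fintype m'] (M : Matrix m m' ℝ) : ℝ :=
  ∑ i, ∑ j, M i j ^ 2

/-- A sparsity set is a set `J` of positions of an `n × K` matrix; `J_{k,l}` consists of
the nodes `i` of community `k` with `(i, l) ∈ J`, so that `|J| = ∑ |J_{k,l}|`. -/
def suppSet {n K : ℕ} (c : Fin n → Fin K) (J : Finset (Fin n × Fin K)) (k l : Fin K) :
    Finset (Community c k) :=
  Finset.univ.filter fun i => (i.1, l) ∈ J

/-! ### The model -/

/-- The matrix of connection probabilities: `P^{(k,l)} = Λ^{(k,l)} (Λ^{(l,k)})ᵀ`, where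
`Λ^{(k,l)}` is the part of column `l` of `Λ` that belongs to the nodes of community `k`. -/
def probMatrix {n K : ℕ} (c : Fin n → Fin K) (Lam : Matrix (Fin n) (Fin K) ℝ) :
    Matrix (Fin n) (Fin n) ℝ :=
  Matrix.of fun i j => Lam i (c j) * Lam j (c i)

/-- The positions of the nonzero entries of `Λ`. -/
def trueSupp {n K : ℕ} (Lam : Matrix (Fin n) (Fin K) ℝ) : Finset (Fin n × Fin K) :=
  Finset.univ.filter fun p => Lam p.1 p.2 ≠ 0

/-- `A` is a random symmetric `0`-`1` matrix whose entries with `i ≤ j` are independent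
Bernoulli variables with means `P i j`. -/
structure IsBernoulliNetwork {n : ℕ} {Ω : Type*} [MeasurableSpace Ω] (μ : Measure Ω)
    (A : Ω → Matrix (Fin n) (Fin n) ℝ) (P : Matrix (Fin n) (Fin n) ℝ) : Prop where
  measurable : ∀ i j, Measurable fun ω => A ω i j
  zero_or_one : ∀ ω i j, A ω i j = 0 ∨ A ω i j = 1
  symm : ∀ ω i j, A ω i j = A ω j i
  prob : ∀ i j, i ≤ j → μ.real {ω | A ω i j = 1} = P i j
  indep : iIndepFun (fun (p : {p : Fin n × Fin n // p.1 ≤ p.2}) ω => A ω p.1.1 p.1.2) μ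

/-! ### The penalties -/

inductive PenaltyKind : Type
  | separable
  | nonseparable

/-- `Pen^{(0,s)}`; a summand with `|J_{k,l}| = 0` is zero. -/
def penZeroSep (β₁ β₂ : ℝ) {n K : ℕ} (c : Fin n → Fin K) (J : Finset (Fin n × Fin K)) : ℝ :=
  β₁ * ∑ k, ∑ l, ((suppSet c J k l).card : ℝ) *
      Real.log ((commSize c k : ℝ) * Real.exp 1 / ((suppSet c J k l).card : ℝ))
    + β₂ * (K : ℝ) * ∑ k, Real.log (commSize c k : ℝ)

/-- `Pen^{(0,ns)}`; the first term is zero if `|J| = 0`. -/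
def penZeroNonsep (β₁ β₂ : ℝ) {n K : ℕ} (J : Finset (Fin n × Fin K)) : ℝ :=
  β₁ * ((J.card : ℝ) * Real.log ((n : ℝ) * (K : ℝ) * Real.exp 1 / (J.card : ℝ)))
    + 2 * β₂ * Real.log (n : ℝ)

/-- `Pen^{(1)}`. -/
def penOne (β₂ : ℝ) (n K : ℕ) : ℝ :=
  β₂ * ((n : ℝ) * Real.log (K : ℝ) + Real.log (n : ℝ))

/-- The total penalty. -/
def pen (a : PenaltyKind) (β₁ β₂ : ℝ) {n K : ℕ} (c : Fin n → Fin K)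
    (J : Finset (Fin n × Fin K)) : ℝ :=
  match a with
  | .separable => penZeroSep β₁ β₂ c J + penOne β₂ n K
  | .nonseparable => penZeroNonsep β₁ β₂ J + penOne β₂ n K

/-- The rate `n ln K + |J| ln (n K e / |J|) + ln n`. -/
def rate {n K : ℕ} (J : Finset (Fin n × Fin K)) : ℝ :=
  (n : ℝ) * Real.log (K : ℝ)
    + (J.card : ℝ) * Real.log ((n : ℝ) * (K : ℝ) * Real.exp 1 / (J.card : ℝ))
    + Real.log (n : ℝ)

/-! ### The optimization problem -/

/-- The feasible points `(Θ, Z, J, K)`. A block whose support `J_{k,l} × J_{l,k}` is empty is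
zero; all other blocks have rank one. -/
structure Feasible (n : ℕ) where
  K : ℕ
  c : Fin n → Fin K
  surj : Function.Surjective c
  J : Finset (Fin n × Fin K)
  Theta : Matrix (Rearranged c) (Rearranged c) ℝ
  rank_le_one : ∀ k l, (block Theta k l).rank ≤ 1
  supp_eq : ∀ k l (i : Community c k) (j : Community c l),
    block Theta k l i j ≠ 0 ↔ i ∈ suppSet c J k l ∧ j ∈ suppSet c J l k

/-- The penalized least-squares criterion. -/
def objective (a : PenaltyKind) (β₁ β₂ : ℝ) {n : ℕ} (A : Matrix (Fin n) (Fin n) ℝ)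
    (s : Feasible n) : ℝ :=
  (∑ k, ∑ l, frobSq (block (rearrange s.c A) k l - block s.Theta k l)) + pen a β₁ β₂ s.c s.J

/-- `s` minimizes the criterion over all feasible points. -/
def IsSolution (a : PenaltyKind) (β₁ β₂ : ℝ) {n : ℕ} (A : Matrix (Fin n) (Fin n) ℝ)
    (s : Feasible n) : Prop :=
  ∀ s' : Feasible n, objective a β₁ β₂ A s ≤ objective a β₁ β₂ A s'

/-- The estimator `P̂`: the block matrix `Θ̂` in the original order of the nodes. -/
def Feasible.estimator {n : ℕ} (s : Feasible n) : Matrix (Fin n) (Fin n) ℝ :=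
  restore s.c s.Theta

/-! ### The constants -/

def betaOne (C₁ C₂ α₁ α₂ : ℝ) : ℝ := 2 * (C₁ + C₂) * (1 + α₂) / α₂ + 2 / α₁

def betaTwo (C₂ α₁ α₂ : ℝ) : ℝ := 2 * C₂ * (1 + α₂) / α₂ + 2 / α₁

def hZero (α₁ α₂ : ℝ) : ℝ := (1 - α₁ - 8 * α₂)⁻¹

def cTilde (C₂ α₁ α₂ : ℝ) : ℝ := 2 * hZero α₁ α₂ * (C₂ + 1 / α₁ + C₂ / α₂)

end

end SPABM

/-! Write `E = A - P` for the noise. Comparing the value of the criterion at the estimator `T` with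
its value at the truth gives the basic inequality
`‖T - P‖² + pen(T) ≤ 2 ⟪E, T - P⟫ + pen(P)`,
so it suffices to bound the noise term by a small multiple of `‖T - P‖²` plus `pen(T)`. For a fixed
clustering and support let `T₀` be the point of the class of matrices with rank-one blocks nearest
to `P`, and split `T - P = (T - T₀) + (T₀ - P)`.

* `⟪E, T₀ - P⟫` is a sum of independent centred variables with fixed coefficients: Hoeffding.
* `T - T₀` varies over blocks of rank at most two, each of which is a sum of two orthogonal rank-one
  blocks. Rounding the two vectors of a rank-one block to a lattice that depends only on the size of
  the support leaves at most `exp (12 |J|)` block matrices, and the supremum of the noise over all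
  rank-one blocks costs only a constant factor over its maximum on these.
* A block with a single entry is not paid for by the separable penalty. Such blocks of `T` are set
  to zero beforehand; since `|E| ≤ 1` entrywise and there are at most `|J|` of them, this changes
  the noise term deterministically by at most a multiple of `|J|`.

The penalty is large enough for the union bound over all clusterings and supports to sum to
`3 exp (-t)`, the squares produced by AM-GM are absorbed on the left, and integrating the
exponential tail bounds the expectation.
-/

namespace SPABM

noncomputable section

section Frobenius

variable {m m' : Type} [Fintype m] [Fintype m']

/-- The Frobenius inner product, whose square norm is `frobSq`. -/
def frobInner (M N : Matrix m m' ℝ) : ℝ :=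
  ∑ i, ∑ j, M i j * N i j

theorem frobSq_nonneg (M : Matrix m m' ℝ) : 0 ≤ frobSq M :=
  Finset.sum_nonneg fun _ _ => Finset.sum_nonneg fun _ _ => sq_nonneg _

theorem frobInner_self (M : Matrix m m' ℝ) : frobInner M M = frobSq M := by
  simp only [frobInner, frobSq, sq]

theorem frobInner_transpose (M N : Matrix m m' ℝ) : frobInner M.transpose N.transpose =
    frobInner M N :=
  Finset.sum_comm

theorem frobInner_add_right (E M N : Matrix m m' ℝ) :
    frobInner E (M + N) = frobInner E M + frobInner E N := by
  simp only [frobInner, Matrix.add_apply, mul_add, Finset.sum_add_distrib]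

theorem frobSq_add (M N : Matrix m m' ℝ) :
    frobSq (M + N) = frobSq M + 2 * frobInner M N + frobSq N := by
  simp only [frobSq, frobInner, Matrix.add_apply, add_sq, Finset.sum_add_distrib, Finset.mul_sum,
    mul_assoc]

theorem frobSq_sub (M N : Matrix m m' ℝ) :
    frobSq (M - N) = frobSq M - 2 * frobInner M N + frobSq N := by
  simp only [frobSq, frobInner, Matrix.sub_apply, sub_sq, Finset.sum_add_distrib,
    Finset.sum_sub_distrib, Finset.mul_sum, mul_assoc]

end Frobenius

section Hoeffding

/-- The weights of the entries on or above the diagonal in the linear functional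
`E ↦ frobInner E W` restricted to symmetric matrices `E`. -/
def foldUpper {ι : Type} [LinearOrder ι] (W : Matrix ι ι ℝ) (p : {p : ι × ι // p.1 ≤ p.2}) : ℝ :=
  W p.1.1 p.1.2 + if p.1.1 < p.1.2 then W p.1.2 p.1.1 else 0

variable {ι : Type} [Fintype ι] [LinearOrder ι]

theorem sum_sum_eq_sum_foldUpper (W : Matrix ι ι ℝ) : ∑ i, ∑ j, W i j = ∑ p, foldUpper W p := by
  have hswap : ∑ p : ι × ι with ¬p.1 ≤ p.2, W p.1 p.2 = ∑ p : ι × ι with p.1 < p.2, W p.2 p.1 :=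
    Finset.sum_equiv (Equiv.prodComm ι ι) (by simp) (by simp)
  have hlt : (Finset.univ.filter fun p : ι × ι => p.1 ≤ p.2).filter (fun p => p.1 < p.2) =
      Finset.univ.filter fun p : ι × ι => p.1 < p.2 := by
    ext p
    simpa using le_of_lt
  rw [← Fintype.sum_prod_type' (f := W),
    ← Finset.sum_filter_add_sum_filter_not _ fun p : ι × ι => p.1 ≤ p.2, hswap, ← hlt,
    Finset.sum_filter (fun p : ι × ι => p.1 < p.2), ← Finset.sum_add_distrib]
  exact Finset.sum_subtype _ (by simp) fun p : ι × ι =>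
    W p.1 p.2 + if p.1 < p.2 then W p.2 p.1 else 0

theorem frobInner_eq_sum_foldUpper {E : Matrix ι ι ℝ} (hE : E.IsSymm) (W : Matrix ι ι ℝ) :
    frobInner E W = ∑ p, foldUpper W p * E p.1.1 p.1.2 := by
  refine (sum_sum_eq_sum_foldUpper (Matrix.of fun i j => E i j * W i j)).trans
    (Finset.sum_congr rfl fun p _ => ?_)
  simp only [foldUpper, Matrix.of_apply, hE.apply p.1.1 p.1.2]
  split_ifs <;> ring

theorem sum_sq_foldUpper_le (W : Matrix ι ι ℝ) : ∑ p, foldUpper W p ^ 2 ≤ 2 * frobSq W := by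
  have hfold := sum_sum_eq_sum_foldUpper (Matrix.of fun i j => W i j ^ 2)
  simp only [Matrix.of_apply] at hfold
  rw [frobSq, hfold, Finset.mul_sum]
  refine Finset.sum_le_sum fun p _ => ?_
  simp only [foldUpper, Matrix.of_apply]
  split_ifs
  · nlinarith [sq_nonneg (W p.1.1 p.1.2 - W p.1.2 p.1.1)]
  · nlinarith [sq_nonneg (W p.1.1 p.1.2)]

theorem measureReal_sqrt_mul_sqrt_lt_le_exp_neg {Ω : Type*} [MeasurableSpace Ω] {μ : Measure Ω}
    [IsFiniteMeasure μ] {X : Ω → ℝ} {c : NNReal} (hX : HasSubgaussianMGF X c μ) {v x : ℝ}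
    (hv : 2 * c ≤ v) (hx : 0 ≤ x) : μ.real {ω | √v * √x < X ω} ≤ Real.exp (-x) := by
  rcases eq_zero_or_pos c with rfl | hc
  · have hle : ∀ᵐ ω ∂μ, X ω ≤ √v * √x := by
      filter_upwards [hX.ae_eq_zero_of_hasSubgaussianMGF_zero] with ω hω
      simp only [hω, Pi.zero_apply]
      positivity
    have hnull : μ {ω | √v * √x < X ω} = 0 := by simpa only [ae_iff, not_le] using hle
    rw [measureReal_def, hnull]
    exact (Real.exp_pos _).le
  · have hc' : (0 : ℝ) < 2 * c := by positivity
    calc μ.real {ω | √v * √x < X ω} ≤ μ.real {ω | √v * √x ≤ X ω} :=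
          measureReal_mono (Set.ofPred_subset_ofPred.2 fun _ => le_of_lt)
      _ ≤ Real.exp (-(√v * √x) ^ 2 / (2 * c)) := hX.measure_ge_le (by positivity)
      _ ≤ Real.exp (-x) := by
          rw [mul_pow, Real.sq_sqrt (hc'.le.trans hv), Real.sq_sqrt hx, neg_div,
            Real.exp_le_exp, neg_le_neg_iff, le_div_iff₀ hc', mul_comm]
          exact mul_le_mul_of_nonneg_right hv hx

end Hoeffding

namespace IsBernoulliNetwork

variable {n : ℕ} {Ω : Type*} [MeasurableSpace Ω] {μ : Measure Ω}
  {A : Ω → Matrix (Fin n) (Fin n) ℝ} {P : Matrix (Fin n) (Fin n) ℝ}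

theorem mem_Icc (hA : IsBernoulliNetwork μ A P) (ω : Ω) (i j : Fin n) :
    A ω i j ∈ Set.Icc (0 : ℝ) 1 := by
  rcases hA.zero_or_one ω i j with h | h <;> simp [h]

variable [IsProbabilityMeasure μ]

theorem mean_mem_Icc (hA : IsBernoulliNetwork μ A P) (hP : P.IsSymm) (i j : Fin n) :
    P i j ∈ Set.Icc (0 : ℝ) 1 := by
  rcases le_total i j with hij | hij
  · exact hA.prob i j hij ▸ ⟨measureReal_nonneg, measureReal_le_one⟩
  · exact hP.apply i j ▸ hA.prob j i hij ▸ ⟨measureReal_nonneg, measureReal_le_one⟩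

theorem hasSubgaussianMGF (hA : IsBernoulliNetwork μ A P) {i j : Fin n} (hij : i ≤ j) :
    HasSubgaussianMGF (fun ω => A ω i j - P i j) (1 / 4) μ := by
  have hindicator : (fun ω => A ω i j) = Set.indicator {ω | A ω i j = 1} fun _ => (1 : ℝ) := by
    funext ω
    rcases hA.zero_or_one ω i j with h | h <;> simp [Set.indicator, h]
  have hmean : μ[fun ω => A ω i j] = P i j := by
    rw [hindicator, integral_indicator_const _ (measurableSet_eq_fun (hA.measurable i j)
      measurable_const), hA.prob i j hij, smul_eq_mul, mul_one]
  have hHoeffding := hasSubgaussianMGF_of_mem_Icc (hA.measurable i j).aemeasurable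
    (ae_of_all μ fun ω => hA.mem_Icc ω i j)
  rw [hmean] at hHoeffding
  convert hHoeffding using 1
  ext
  norm_num

theorem measureReal_lt_frobInner_le (hA : IsBernoulliNetwork μ A P) (hP : P.IsSymm)
    (W : Matrix (Fin n) (Fin n) ℝ) {x : ℝ} (hx : 0 ≤ x) :
    μ.real {ω | √(frobSq W) * √x < frobInner (A ω - P) W} ≤ Real.exp (-x) := by
  have hsymm (ω : Ω) : (A ω - P).IsSymm :=
    Matrix.IsSymm.sub (Matrix.IsSymm.ext fun i j => hA.symm ω j i) hP
  have hindep : iIndepFun (fun (p : {p : Fin n × Fin n // p.1 ≤ p.2}) ω =>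
      foldUpper W p * (A ω p.1.1 p.1.2 - P p.1.1 p.1.2)) μ :=
    hA.indep.comp (fun p y => foldUpper W p * (y - P p.1.1 p.1.2)) fun p => by fun_prop
  have hsubgaussian := HasSubgaussianMGF.sum_of_iIndepFun hindep (s := Finset.univ)
    fun p _ => (hA.hasSubgaussianMGF p.2).const_mul (foldUpper W p)
  have hscale : 2 * ((∑ p, NNReal.mk (foldUpper W p ^ 2) (sq_nonneg _) * (1 / 4) : NNReal) : ℝ) =
      (∑ p, foldUpper W p ^ 2) / 2 := by
    simp only [NNReal.coe_sum, NNReal.coe_mul, NNReal.coe_mk, ← Finset.sum_mul]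
    push_cast
    ring
  simp only [frobInner_eq_sum_foldUpper (hsymm _), Matrix.sub_apply]
  refine measureReal_sqrt_mul_sqrt_lt_le_exp_neg hsubgaussian (hscale.trans_le ?_) hx
  linarith [sum_sq_foldUpper_le W]

end IsBernoulliNetwork

section Lattice

theorem exists_int_sq_le_and_sub_sq_le_one (y : ℝ) :
    ∃ z : ℤ, (z : ℝ) ^ 2 ≤ y ^ 2 ∧ (y - z) ^ 2 ≤ 1 := by
  wlog hy : 0 ≤ y generalizing y
  · obtain ⟨z, hz, hyz⟩ := this (-y) (by linarith)
    exact ⟨-z, by simpa using hz, by push_cast; linarith⟩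
  · have hfloor : (0 : ℝ) ≤ ⌊y⌋ := by exact_mod_cast Int.floor_nonneg.2 hy
    refine ⟨⌊y⌋, pow_le_pow_left₀ hfloor (Int.floor_le y) 2, ?_⟩
    nlinarith [Int.floor_le y, Int.lt_floor_add_one y]

variable {ι : Type*}

theorem exists_lattice_approx (s : Finset ι) {u : ι → ℝ} (hu : ∑ q ∈ s, u q ^ 2 ≤ 1) :
    ∃ z : ι → ℤ, (∀ q ∉ s, z q = 0) ∧ ∑ q ∈ s, (z q : ℝ) ^ 2 ≤ 4 * s.card ∧
      ∑ q ∈ s, (u q - z q / (2 * √s.card)) ^ 2 ≤ 1 / 4 := by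
  classical
  choose round hround_sq hround_sub using exists_int_sq_le_and_sub_sq_le_one
  have hsq : √(s.card : ℝ) ^ 2 = s.card := Real.sq_sqrt (Nat.cast_nonneg _)
  refine ⟨fun q => if q ∈ s then round (2 * √s.card * u q) else 0, fun q hq => if_neg hq, ?_, ?_⟩
  · calc ∑ q ∈ s, ((if q ∈ s then round (2 * √s.card * u q) else 0 : ℤ) : ℝ) ^ 2
        ≤ ∑ q ∈ s, (2 * √s.card * u q) ^ 2 :=
          Finset.sum_le_sum fun q hq => by simpa only [if_pos hq] using hround_sq _
      _ = 4 * s.card * ∑ q ∈ s, u q ^ 2 := by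
          rw [Finset.mul_sum]
          exact Finset.sum_congr rfl fun q _ => by rw [mul_pow, mul_pow, hsq]; norm_num
      _ ≤ 4 * s.card := mul_le_of_le_one_right (by positivity) hu
  · have hentry : ∀ q ∈ s, (u q - (if q ∈ s then round (2 * √s.card * u q) else 0 : ℤ) /
        (2 * √s.card)) ^ 2 ≤ 1 / (4 * s.card) := by
      intro q hq
      have hs : 0 < √(s.card : ℝ) := Real.sqrt_pos.2 (by exact_mod_cast Finset.card_pos.2 ⟨q, hq⟩)
      rw [if_pos hq, sub_div' (by positivity), div_pow, mul_pow, hsq, mul_comm (u q)]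
      norm_num only
      gcongr
      exact hround_sub _
    calc _ ≤ ∑ _q ∈ s, 1 / (4 * s.card : ℝ) := Finset.sum_le_sum hentry
      _ = s.card / s.card / 4 := by rw [Finset.sum_const, nsmul_eq_mul]; ring
      _ ≤ 1 / 4 := by gcongr; exact div_self_le_one _

theorem exists_lattice_dual (s : Finset ι) (g : ι → ℝ) :
    ∃ z : ι → ℤ, (∀ q ∉ s, z q = 0) ∧ ∑ q ∈ s, (z q : ℝ) ^ 2 ≤ 4 * s.card ∧
      √(∑ q ∈ s, g q ^ 2) / 2 ≤ ∑ q ∈ s, g q * (z q / (2 * √s.card)) := by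
  set N := √(∑ q ∈ s, g q ^ 2)
  have hN : N ^ 2 = ∑ q ∈ s, g q ^ 2 := Real.sq_sqrt (Finset.sum_nonneg fun _ _ => sq_nonneg _)
  have hunit : ∑ q ∈ s, (g q / N) ^ 2 ≤ 1 := by
    simp only [div_pow, ← Finset.sum_div, ← hN]
    exact div_self_le_one _
  obtain ⟨z, hz, hzs, happrox⟩ := exists_lattice_approx s hunit
  refine ⟨z, hz, hzs, ?_⟩
  have hdual : ∑ q ∈ s, g q * (g q / N) = N := by
    simp only [← mul_div_assoc, ← sq, ← Finset.sum_div, ← hN]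
    rw [sq, mul_self_div_self]
  have hsqrt : √(∑ q ∈ s, (g q / N - z q / (2 * √s.card)) ^ 2) ≤ 1 / 2 :=
    Real.sqrt_le_iff.2 ⟨by norm_num, happrox.trans_eq (by norm_num)⟩
  have herror : ∑ q ∈ s, g q * (g q / N - z q / (2 * √s.card)) ≤ N * (1 / 2) :=
    (Real.sum_mul_le_sqrt_mul_sqrt _ _ _).trans
      (mul_le_mul_of_nonneg_left hsqrt (Real.sqrt_nonneg _))
  simp only [mul_sub, Finset.sum_sub_distrib, hdual] at herror
  linarith

variable [Fintype ι] [DecidableEq ι]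

/-- The range of the `q`-th coordinate of a point of `latticeNet s`. -/
def latticeRange (s : Finset ι) (q : ι) : Finset ℤ :=
  if q ∈ s then Finset.Icc (-(4 * s.card : ℕ)) (4 * s.card : ℕ) else {0}

/-- The integer points supported in `s` with squared norm at most `4 |s|`. Divided by `2 √|s|`
they form a finite net of the unit ball of `ℝ^s`. -/
def latticeNet (s : Finset ι) : Finset (ι → ℤ) :=
  (Fintype.piFinset (latticeRange s)).filter fun z => ∑ q ∈ s, (z q : ℝ) ^ 2 ≤ 4 * s.card

theorem mem_latticeNet {s : Finset ι} {z : ι → ℤ} :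
    z ∈ latticeNet s ↔ (∀ q ∉ s, z q = 0) ∧ ∑ q ∈ s, (z q : ℝ) ^ 2 ≤ 4 * s.card := by
  rw [latticeNet, Finset.mem_filter, Fintype.mem_piFinset]
  refine and_congr_left fun hz => ⟨fun h q hq => by simpa [latticeRange, hq] using h q,
    fun h q => ?_⟩
  by_cases hq : q ∈ s
  · have hsq : (z q : ℝ) ^ 2 ≤ 4 * s.card :=
      (Finset.single_le_sum (f := fun q => (z q : ℝ) ^ 2) (fun _ _ => sq_nonneg _) hq).trans hz
    have hsq' : z q ^ 2 ≤ (4 * s.card : ℕ) := by exact_mod_cast hsq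
    rw [latticeRange, if_pos hq, Finset.mem_Icc, ← abs_le]
    exact (Int.le_self_sq _).trans ((sq_abs _).trans_le hsq')
  · simp [latticeRange, hq, h q hq]

theorem sum_Icc_exp_neg_sq_le_five (B : ℕ) :
    ∑ m ∈ Finset.Icc (-(B : ℤ)) B, Real.exp (-(m : ℝ) ^ 2) ≤ 5 := by
  have hterm (m : ℕ) : Real.exp (-(m : ℝ) ^ 2) ≤ (1 / 2) ^ m := by
    calc Real.exp (-(m : ℝ) ^ 2) ≤ Real.exp (-(m : ℝ)) :=
          Real.exp_le_exp.2 (neg_le_neg (by exact_mod_cast Nat.le_self_pow two_ne_zero m))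
      _ = Real.exp (-1) ^ m := by rw [← Real.exp_nat_mul, mul_neg_one]
      _ ≤ (1 / 2) ^ m := by
          gcongr
          linarith [Real.exp_neg_one_lt_d9]
  have hhalf : ∑ m ∈ Finset.range (B + 1), Real.exp (-(m : ℝ) ^ 2) ≤ 2 :=
    (Finset.sum_le_sum fun m _ => hterm m).trans (sum_geometric_two_le _)
  rw [Finset.sum_Icc_of_even_eq_range (f := fun m : ℤ => Real.exp (-(m : ℝ) ^ 2))
    (fun m => by simp)]
  norm_num
  linarith

theorem sum_exp_neg_sum_sq_le (s : Finset ι) :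
    ∑ z ∈ Fintype.piFinset (latticeRange s), Real.exp (-∑ q ∈ s, (z q : ℝ) ^ 2) ≤
      Real.exp 2 ^ s.card := by
  have hexp : 5 ≤ Real.exp 2 := by
    rw [← one_add_one_eq_two, Real.exp_add]
    nlinarith [Real.exp_one_gt_d9]
  have hfactor (q : ι) : ∑ m ∈ latticeRange s q, (if q ∈ s then Real.exp (-(m : ℝ) ^ 2) else 1) ≤
      if q ∈ s then Real.exp 2 else 1 := by
    unfold latticeRange
    split_ifs
    · exact (sum_Icc_exp_neg_sq_le_five _).trans hexp
    · simp
  calc ∑ z ∈ Fintype.piFinset (latticeRange s), Real.exp (-∑ q ∈ s, (z q : ℝ) ^ 2)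
      = ∑ z ∈ Fintype.piFinset (latticeRange s),
          ∏ q, if q ∈ s then Real.exp (-(z q : ℝ) ^ 2) else 1 :=
        Finset.sum_congr rfl fun z _ => by
          rw [Finset.prod_ite_mem, Finset.univ_inter, ← Real.exp_sum, Finset.sum_neg_distrib]
    _ = ∏ q, ∑ m ∈ latticeRange s q, if q ∈ s then Real.exp (-(m : ℝ) ^ 2) else 1 :=
        by rw [Finset.prod_univ_sum]
    _ ≤ ∏ q, if q ∈ s then Real.exp 2 else 1 :=
        Finset.prod_le_prod (fun q _ => Finset.sum_nonneg fun m _ => by positivity)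
          fun q _ => hfactor q
    _ = Real.exp 2 ^ s.card := by
        rw [Finset.prod_ite_mem, Finset.univ_inter, Finset.prod_const]

theorem card_latticeNet_le (s : Finset ι) : ((latticeNet s).card : ℝ) ≤ Real.exp (6 * s.card) := by
  calc ((latticeNet s).card : ℝ) = ∑ z ∈ latticeNet s, 1 := by simp
    _ ≤ ∑ z ∈ latticeNet s, Real.exp (4 * s.card - ∑ q ∈ s, (z q : ℝ) ^ 2) :=
        Finset.sum_le_sum fun z hz =>
          Real.one_le_exp (sub_nonneg.2 (mem_latticeNet.1 hz).2)
    _ ≤ ∑ z ∈ Fintype.piFinset (latticeRange s),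
          Real.exp (4 * s.card - ∑ q ∈ s, (z q : ℝ) ^ 2) :=
        Finset.sum_le_sum_of_subset_of_nonneg (Finset.filter_subset _ _)
          fun _ _ _ => (Real.exp_pos _).le
    _ ≤ Real.exp (4 * s.card) * Real.exp 2 ^ s.card := by
        simp only [sub_eq_add_neg, Real.exp_add, ← Finset.mul_sum]
        gcongr
        exact sum_exp_neg_sum_sq_le s
    _ = Real.exp (6 * s.card) := by
        rw [← Real.exp_nat_mul, ← Real.exp_add]
        ring_nf

theorem exists_fiberwise_lattice_dual {β : Type*} [Fintype β] [DecidableEq β] (f : ι → β)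
    (s : Finset ι) (g : ι → ℝ) :
    ∃ z ∈ latticeNet s, (∀ b, ∑ q ∈ s with f q = b, (z q : ℝ) ^ 2 ≤ 4 * {q ∈ s | f q = b}.card) ∧
      (∑ b, √(∑ q ∈ s with f q = b, g q ^ 2)) / 2 ≤
        ∑ q ∈ s, g q * (z q / (2 * √{p ∈ s | f p = f q}.card)) := by
  choose z hz hzs hdual using fun b => exists_lattice_dual {q ∈ s | f q = b} g
  have hfiber {F : ι → ℤ → ℝ} (b : β) : ∑ q ∈ s with f q = b, F q (z (f q) q) =
      ∑ q ∈ s with f q = b, F q (z b q) :=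
    Finset.sum_congr rfl fun q hq => by rw [(Finset.mem_filter.1 hq).2]
  have hbound (b : β) : ∑ q ∈ s with f q = b, (z (f q) q : ℝ) ^ 2 ≤ 4 * {q ∈ s | f q = b}.card :=
    (hfiber (F := fun _ y => (y : ℝ) ^ 2) b).trans_le (hzs b)
  refine ⟨fun q => z (f q) q, mem_latticeNet.2 ⟨fun q hq => hz _ q (by simp [hq]), ?_⟩, hbound, ?_⟩
  · rw [← Finset.sum_fiberwise s f, Finset.card_eq_sum_card_fiberwise (f := f)
      (fun _ _ => Finset.mem_coe.2 (Finset.mem_univ _)), Nat.cast_sum, Finset.mul_sum]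
    exact Finset.sum_le_sum fun b _ => hbound b
  · rw [← Finset.sum_fiberwise s f, Finset.sum_div]
    refine Finset.sum_le_sum fun b _ => (hdual b).trans_eq (Finset.sum_congr rfl fun q hq => ?_)
    simp only [(Finset.mem_filter.1 hq).2]

end Lattice

section BlockOuter

variable {ι κ : Type}

/-- The block `(k, l)` to which the entry `(i, l)` of `Λ` belongs: `i` lies in community `k`. -/
def blockOf (c : ι → κ) (q : ι × κ) : κ × κ := (c q.1, q.2)

/-- The matrix whose `(k, l)` block is the outer product of the parts of `x` and `v` that belong
to the blocks `(k, l)` and `(l, k)`. -/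
def blockOuter (c : ι → κ) (x v : ι × κ → ℝ) : Matrix ι ι ℝ :=
  Matrix.of fun i j => x (i, c j) * v (j, c i)

theorem transpose_blockOuter (c : ι → κ) (x v : ι × κ → ℝ) :
    (blockOuter c x v).transpose = blockOuter c v x := by
  ext i j
  exact mul_comm _ _

variable [DecidableEq κ]

/-- The gradient of `x ↦ frobInner E (blockOuter c x v)`. -/
def blockContract [Fintype ι] (c : ι → κ) (E : Matrix ι ι ℝ) (v : ι × κ → ℝ) (q : ι × κ) : ℝ :=
  ∑ j with c j = q.2, E q.1 j * v (j, c q.1)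

variable [Fintype ι] [Fintype κ]

theorem frobInner_blockOuter (c : ι → κ) (E : Matrix ι ι ℝ) (x v : ι × κ → ℝ) :
    frobInner E (blockOuter c x v) = ∑ q, blockContract c E v q * x q := by
  rw [frobInner, Fintype.sum_prod_type]
  refine Finset.sum_congr rfl fun i _ => ?_
  rw [← Finset.sum_fiberwise Finset.univ c]
  refine Finset.sum_congr rfl fun k _ => ?_
  rw [blockContract, Finset.sum_mul]
  refine Finset.sum_congr rfl fun j hj => ?_
  obtain rfl := (Finset.mem_filter.1 hj).2
  simp only [blockOuter, Matrix.of_apply]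
  ring

theorem frobInner_blockOuter' (c : ι → κ) (E : Matrix ι ι ℝ) (x v : ι × κ → ℝ) :
    frobInner E (blockOuter c x v) = ∑ q, blockContract c E.transpose x q * v q := by
  rw [← frobInner_transpose, transpose_blockOuter, frobInner_blockOuter]

/-- The squared norm of the part of `v` that belongs to the block `b`. -/
def blockNormSq (c : ι → κ) (v : ι × κ → ℝ) (b : κ × κ) : ℝ :=
  ∑ q with blockOf c q = b, v q ^ 2

theorem blockNormSq_nonneg (c : ι → κ) (v : ι × κ → ℝ) (b : κ × κ) : 0 ≤ blockNormSq c v b :=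
  Finset.sum_nonneg fun _ _ => sq_nonneg _

theorem eq_zero_of_blockNormSq_eq_zero {c : ι → κ} {v : ι × κ → ℝ} {q : ι × κ}
    (h : blockNormSq c v (blockOf c q) = 0) : v q = 0 :=
  sq_eq_zero_iff.1 ((Finset.sum_eq_zero_iff_of_nonneg fun _ _ => sq_nonneg _).1 h q (by simp))

theorem sum_blockOf_eq (c : ι → κ) (k l : κ) (f : ι × κ → ℝ) :
    ∑ q with blockOf c q = (k, l), f q = ∑ j with c j = k, f (j, l) := by
  refine (Finset.sum_bij (fun j _ => (j, l)) ?_ ?_ ?_ fun _ _ => rfl).symm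
  · simp [blockOf]
  · simp
  · rintro ⟨j, l'⟩ h
    obtain ⟨hj, rfl⟩ : c j = k ∧ l' = l := by simpa [blockOf] using h
    exact ⟨j, by simp [hj], rfl⟩

theorem frobInner_blockOuter_blockOuter (c : ι → κ) (x v x' v' : ι × κ → ℝ) :
    frobInner (blockOuter c x v) (blockOuter c x' v') =
      ∑ b, (∑ q with blockOf c q = b, x q * x' q) * ∑ q with blockOf c q = b.swap, v q * v' q := by
  have hcontract (q : ι × κ) : blockContract c (blockOuter c x v) v' q =
      x q * ∑ p with blockOf c p = (blockOf c q).swap, v p * v' p := by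
    obtain ⟨i, k⟩ := q
    rw [blockOf, Prod.swap, sum_blockOf_eq, blockContract, Finset.mul_sum]
    refine Finset.sum_congr rfl fun j hj => ?_
    obtain rfl := (Finset.mem_filter.1 hj).2
    exact mul_assoc _ _ _
  rw [frobInner_blockOuter, ← Finset.sum_fiberwise Finset.univ (blockOf c)]
  refine Finset.sum_congr rfl fun b _ => ?_
  rw [Finset.sum_mul]
  refine Finset.sum_congr rfl fun q hq => ?_
  rw [hcontract, (Finset.mem_filter.1 hq).2]
  ring

theorem frobSq_blockOuter (c : ι → κ) (x v : ι × κ → ℝ) :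
    frobSq (blockOuter c x v) = ∑ b, blockNormSq c x b * blockNormSq c v b.swap := by
  simp only [← frobInner_self, frobInner_blockOuter_blockOuter, blockNormSq, sq]

end BlockOuter

section LatticeBound

variable {ι κ : Type} [Fintype ι] [Fintype κ] [DecidableEq κ] {c : ι → κ} {J : Finset (ι × κ)}

/-- The positions of `J` that belong to the block `b`. -/
abbrev blockSupp (c : ι → κ) (J : Finset (ι × κ)) (b : κ × κ) : Finset (ι × κ) :=
  {q ∈ J | blockOf c q = b}

theorem sum_eq_sum_of_support {α : Type*} [Fintype α] {s : Finset α} {v : α → ℝ}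
    (hv : ∀ q ∉ s, v q = 0) (g : α → ℝ) : ∑ q, g q * v q = ∑ q ∈ s, g q * v q :=
  (Finset.sum_subset (Finset.subset_univ s) fun q _ hq => by rw [hv q hq, mul_zero]).symm

theorem blockNormSq_eq_sum_blockSupp {v : ι × κ → ℝ} (hv : ∀ q ∉ J, v q = 0) (b : κ × κ) :
    blockNormSq c v b = ∑ q ∈ blockSupp c J b, v q ^ 2 := by
  refine (Finset.sum_subset (Finset.filter_subset_filter _ (Finset.subset_univ J))
    fun q hq hqJ => ?_).symm
  have hb := (Finset.mem_filter.1 hq).2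
  rw [hv q fun hJ => hqJ (Finset.mem_filter.2 ⟨hJ, hb⟩)]
  exact zero_pow two_ne_zero

theorem sum_mul_le_sum_sqrt_blockSupp {v : ι × κ → ℝ} (hv : ∀ q ∉ J, v q = 0)
    (hunit : ∀ b, blockNormSq c v b ≤ 1) (g : ι × κ → ℝ) :
    ∑ q, g q * v q ≤ ∑ b, √(∑ q ∈ blockSupp c J b, g q ^ 2) := by
  rw [sum_eq_sum_of_support hv, ← Finset.sum_fiberwise J (blockOf c)]
  refine Finset.sum_le_sum fun b _ => (Real.sum_mul_le_sqrt_mul_sqrt _ _ _).trans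
    (mul_le_of_le_one_right (Real.sqrt_nonneg _) (Real.sqrt_le_one.2 ?_))
  exact (blockNormSq_eq_sum_blockSupp hv b).symm.trans_le (hunit b)

/-- The point of the discretized class of block matrices given by a pair of integer points: the
first one is normalized as a whole, the second one block by block. -/
def latticeOuter (c : ι → κ) (J : Finset (ι × κ)) (z z' : ι × κ → ℤ) : Matrix ι ι ℝ :=
  blockOuter c (fun q => z q / (2 * √J.card))
    fun q => z' q / (2 * √(blockSupp c J (blockOf c q)).card)

variable [DecidableEq ι]

/-- The linear functional of `E` is at most `B` times the Frobenius norm on the discretized class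
of block matrices supported in `J`. -/
def LatticeBounded (c : ι → κ) (J : Finset (ι × κ)) (E : Matrix ι ι ℝ) (B : ℝ) : Prop :=
  ∀ z ∈ latticeNet J, ∀ z' ∈ latticeNet J,
    frobInner E (latticeOuter c J z z') ≤ √(frobSq (latticeOuter c J z z')) * B

theorem sum_div_sq_le_one {α : Type*} {s : Finset α} {z : α → ℤ}
    (hz : ∑ q ∈ s, (z q : ℝ) ^ 2 ≤ 4 * s.card) : ∑ q ∈ s, (z q / (2 * √s.card) : ℝ) ^ 2 ≤ 1 := by
  simp_rw [div_pow, mul_pow, Real.sq_sqrt (Nat.cast_nonneg s.card)]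
  rw [← Finset.sum_div]
  exact div_le_one_of_le₀ (by linarith) (by positivity)

theorem frobSq_latticeOuter_le_one {z z' : ι × κ → ℤ} (hz : z ∈ latticeNet J)
    (hz' : ∀ q ∉ J, z' q = 0) (hblock : ∀ b, ∑ q ∈ blockSupp c J b, (z' q : ℝ) ^ 2 ≤
      4 * (blockSupp c J b).card) : frobSq (latticeOuter c J z z') ≤ 1 := by
  obtain ⟨hzJ, hzsq⟩ := mem_latticeNet.1 hz
  have hright (b : κ × κ) : blockNormSq c
      (fun q => z' q / (2 * √(blockSupp c J (blockOf c q)).card)) b ≤ 1 := by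
    rw [blockNormSq_eq_sum_blockSupp (J := J) fun q hq => by simp [hz' q hq]]
    refine (Finset.sum_congr rfl fun q hq => ?_).trans_le (sum_div_sq_le_one (hblock b))
    rw [(Finset.mem_filter.1 hq).2]
  calc frobSq (latticeOuter c J z z')
      ≤ ∑ b, blockNormSq c (fun q => z q / (2 * √J.card)) b := by
        rw [latticeOuter, frobSq_blockOuter]
        exact Finset.sum_le_sum fun b _ =>
          mul_le_of_le_one_right (blockNormSq_nonneg _ _ _) (hright b.swap)
    _ = ∑ q ∈ J, (z q / (2 * √J.card) : ℝ) ^ 2 := by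
        simp only [blockNormSq_eq_sum_blockSupp (J := J) (v := fun q => z q / (2 * √J.card))
          fun q hq => by simp [hzJ q hq]]
        exact Finset.sum_fiberwise J (blockOf c) _
    _ ≤ 1 := sum_div_sq_le_one hzsq

namespace LatticeBounded

variable {E : Matrix ι ι ℝ} {B : ℝ}

theorem frobInner_le_right (hE : LatticeBounded c J E B) (hB : 0 ≤ B) {z : ι × κ → ℤ}
    (hz : z ∈ latticeNet J) {v : ι × κ → ℝ} (hv : ∀ q ∉ J, v q = 0)
    (hunit : ∀ b, blockNormSq c v b ≤ 1) :
    frobInner E (blockOuter c (fun q => z q / (2 * √J.card)) v) ≤ 2 * B := by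
  set g := blockContract c E.transpose fun q => z q / (2 * √J.card) with hg
  obtain ⟨z', hz', hblock, hdual⟩ := exists_fiberwise_lattice_dual (blockOf c) J g
  have hz'J := (mem_latticeNet.1 hz').1
  have hlattice : frobInner E (latticeOuter c J z z') ≤ B :=
    (hE z hz z' hz').trans (mul_le_of_le_one_left hB
      (Real.sqrt_le_one.2 (frobSq_latticeOuter_le_one hz hz'J hblock)))
  rw [latticeOuter, frobInner_blockOuter', ← hg,
    sum_eq_sum_of_support (s := J) fun q hq => by simp [hz'J q hq]] at hlattice
  have hsum : ∑ q, g q * v q ≤ ∑ b, √(∑ q ∈ blockSupp c J b, g q ^ 2) :=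
    sum_mul_le_sum_sqrt_blockSupp hv hunit g
  rw [frobInner_blockOuter', ← hg]
  linarith [hdual.trans hlattice]

theorem frobInner_le_of_blockNormSq_le_one (hE : LatticeBounded c J E B) (hB : 0 ≤ B)
    {x v : ι × κ → ℝ} (hx : ∀ q ∉ J, x q = 0) (hv : ∀ q ∉ J, v q = 0)
    (hunit : ∀ b, blockNormSq c v b ≤ 1) :
    frobInner E (blockOuter c x v) ≤ 4 * B * √(∑ q ∈ J, x q ^ 2) := by
  obtain ⟨z, hzJ, hzsq, hdual⟩ := exists_lattice_dual J (blockContract c E v)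
  have hlattice := hE.frobInner_le_right hB (mem_latticeNet.2 ⟨hzJ, hzsq⟩) hv hunit
  rw [frobInner_blockOuter, sum_eq_sum_of_support (s := J) fun q hq => by simp [hzJ q hq]]
    at hlattice
  rw [frobInner_blockOuter, sum_eq_sum_of_support hx]
  exact (Real.sum_mul_le_sqrt_mul_sqrt _ _ _).trans
    (mul_le_mul_of_nonneg_right (by linarith) (Real.sqrt_nonneg _))

theorem frobInner_blockOuter_le (hE : LatticeBounded c J E B) (hB : 0 ≤ B) {x v : ι × κ → ℝ}
    (hx : ∀ q ∉ J, x q = 0) (hv : ∀ q ∉ J, v q = 0) :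
    frobInner E (blockOuter c x v) ≤ 4 * B * √(frobSq (blockOuter c x v)) := by
  set x' : ι × κ → ℝ := fun q => x q * √(blockNormSq c v (blockOf c q).swap) with hx'
  set v' : ι × κ → ℝ := fun q => v q / √(blockNormSq c v (blockOf c q)) with hv'
  have houter : blockOuter c x' v' = blockOuter c x v := by
    ext i j
    have hcancel : √(blockNormSq c v (blockOf c (j, c i))) * v' (j, c i) = v (j, c i) :=
      mul_div_cancel_of_imp' fun h0 => eq_zero_of_blockNormSq_eq_zero
        ((Real.sqrt_eq_zero (blockNormSq_nonneg _ _ _)).1 h0)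
    simp only [blockOuter, Matrix.of_apply, hx', mul_assoc]
    exact congrArg _ hcancel
  have hunit (b : κ × κ) : blockNormSq c v' b ≤ 1 := by
    calc blockNormSq c v' b = ∑ q with blockOf c q = b, v q ^ 2 / blockNormSq c v b :=
          Finset.sum_congr rfl fun q hq => by
            rw [hv', div_pow, Real.sq_sqrt (blockNormSq_nonneg _ _ _), (Finset.mem_filter.1 hq).2]
      _ = blockNormSq c v b / blockNormSq c v b := (Finset.sum_div _ _ _).symm
      _ ≤ 1 := div_self_le_one _
  have hx'J (q : ι × κ) (hq : q ∉ J) : x' q = 0 := by simp only [hx', hx q hq, zero_mul]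
  have hnorm : ∑ q ∈ J, x' q ^ 2 = frobSq (blockOuter c x v) := by
    rw [frobSq_blockOuter, ← Finset.sum_fiberwise J (blockOf c)]
    refine Finset.sum_congr rfl fun b _ => ?_
    rw [blockNormSq_eq_sum_blockSupp hx, Finset.sum_mul]
    refine Finset.sum_congr rfl fun q hq => ?_
    rw [hx', mul_pow, Real.sq_sqrt (blockNormSq_nonneg _ _ _), (Finset.mem_filter.1 hq).2]
  rw [← hnorm, ← houter]
  exact hE.frobInner_le_of_blockNormSq_le_one hB hx'J
    (fun q hq => by simp only [hv', hv q hq, zero_div]) hunit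

end LatticeBounded

end LatticeBound

section RankOneClass

variable {ι κ : Type}

/-- The matrices all of whose blocks have rank at most one and are supported in
`J_{k,l} × J_{l,k}`. The rank condition is expressed through the `2 × 2` minors, which makes the
class visibly closed. -/
def rankOneClass (c : ι → κ) (J : Finset (ι × κ)) : Set (Matrix ι ι ℝ) :=
  {T | (∀ i j i' j', c i = c i' → c j = c j' → T i j * T i' j' = T i j' * T i' j) ∧
    ∀ i j, ¬((i, c j) ∈ J ∧ (j, c i) ∈ J) → T i j = 0}

variable {c : ι → κ} {J : Finset (ι × κ)}

theorem exists_eq_mul_on_block {T : Matrix ι ι ℝ} (hT : T ∈ rankOneClass c J) (k l : κ) :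
    ∃ a b : ι → ℝ, (∀ i, c i = k → (i, l) ∉ J → a i = 0) ∧
      (∀ j, c j = l → (j, k) ∉ J → b j = 0) ∧ ∀ i j, c i = k → c j = l → T i j = a i * b j := by
  by_cases h : ∃ i₀ j₀, c i₀ = k ∧ c j₀ = l ∧ T i₀ j₀ ≠ 0
  · obtain ⟨i₀, j₀, rfl, rfl, h0⟩ := h
    refine ⟨fun i => T i j₀, fun j => T i₀ j / T i₀ j₀, fun i _ hi => hT.2 i j₀ fun h => hi h.1,
      fun j _ hj => ?_, fun i j hi hj => ?_⟩
    · simp only [hT.2 i₀ j fun h => hj h.2, zero_div]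
    · rw [← mul_div_assoc, eq_div_iff h0]
      exact hT.1 i j i₀ j₀ hi hj
  · push Not at h
    exact ⟨0, 0, fun _ _ _ => rfl, fun _ _ _ => rfl, fun i j hi hj => by simp [h i j hi hj]⟩

theorem exists_eq_blockOuter {T : Matrix ι ι ℝ} (hT : T ∈ rankOneClass c J) :
    ∃ a b : ι × κ → ℝ, (∀ q ∉ J, a q = 0) ∧ (∀ q ∉ J, b q = 0) ∧ T = blockOuter c a b := by
  choose a b ha hb hab using exists_eq_mul_on_block hT
  refine ⟨fun q => a (c q.1) q.2 q.1, fun q => b q.2 (c q.1) q.1,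
    fun q hq => ha _ _ _ rfl hq, fun q hq => hb _ _ _ rfl hq, ?_⟩
  ext i j
  exact hab _ _ i j rfl rfl

theorem isClosed_rankOneClass (c : ι → κ) (J : Finset (ι × κ)) : IsClosed (rankOneClass c J) := by
  have hentry (i j : ι) : Continuous fun T : Matrix ι ι ℝ => T i j := by fun_prop
  simp only [rankOneClass, Set.ofPred_and, Set.ofPred_forall]
  refine .inter ?_ ?_
  · exact isClosed_iInter fun i => isClosed_iInter fun j => isClosed_iInter fun i' =>
      isClosed_iInter fun j' => isClosed_iInter fun _ => isClosed_iInter fun _ =>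
        isClosed_eq ((hentry _ _).mul (hentry _ _)) ((hentry _ _).mul (hentry _ _))
  · exact isClosed_iInter fun i => isClosed_iInter fun j => isClosed_iInter fun _ =>
      isClosed_eq (hentry _ _) continuous_const

section Nearest

open scoped Matrix.Norms.Frobenius

variable [Fintype ι]

theorem frobSq_eq_norm_sq (M : Matrix ι ι ℝ) : frobSq M = ‖M‖ ^ 2 := by
  have hnonneg : 0 ≤ ∑ i, ∑ j, ‖M i j‖ ^ (2 : ℝ) := by positivity
  rw [Matrix.frobenius_norm_def, ← Real.sqrt_eq_rpow, Real.sq_sqrt hnonneg]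
  simp [frobSq]

theorem exists_nearest_rankOneClass (c : ι → κ) (J : Finset (ι × κ)) (P : Matrix ι ι ℝ) :
    ∃ T₀ ∈ rankOneClass c J, ∀ T ∈ rankOneClass c J, frobSq (T₀ - P) ≤ frobSq (T - P) := by
  have : ProperSpace (Matrix ι ι ℝ) := FiniteDimensional.proper ℝ _
  have hne : (rankOneClass c J).Nonempty := ⟨0, by simp [rankOneClass]⟩
  obtain ⟨T₀, hT₀, hmin⟩ := (isClosed_rankOneClass c J).exists_infDist_eq_dist hne P
  refine ⟨T₀, hT₀, fun T hT => ?_⟩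
  have hdist : dist P T₀ ≤ dist P T := hmin ▸ Metric.infDist_le_dist_of_mem hT
  rw [dist_comm, dist_eq_norm, dist_comm, dist_eq_norm] at hdist
  simpa only [frobSq_eq_norm_sq] using pow_le_pow_left₀ (norm_nonneg _) hdist 2

end Nearest

variable [Fintype ι]

/-- A point of `rankOneClass c J` at minimal Frobenius distance from `P`. -/
def nearest (c : ι → κ) (J : Finset (ι × κ)) (P : Matrix ι ι ℝ) : Matrix ι ι ℝ :=
  (exists_nearest_rankOneClass c J P).choose

theorem nearest_mem (c : ι → κ) (J : Finset (ι × κ)) (P : Matrix ι ι ℝ) :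
    nearest c J P ∈ rankOneClass c J :=
  (exists_nearest_rankOneClass c J P).choose_spec.1

theorem frobSq_nearest_sub_le {T : Matrix ι ι ℝ} (hT : T ∈ rankOneClass c J) (P : Matrix ι ι ℝ) :
    frobSq (nearest c J P - P) ≤ frobSq (T - P) :=
  (exists_nearest_rankOneClass c J P).choose_spec.2 T hT

theorem exists_sum_mul_sub_mul_eq_zero {α : Type*} (s : Finset α) (a a₀ : α → ℝ) :
    ∃ τ : ℝ, ∑ q ∈ s, a q * (τ * a q - a₀ q) = 0 := by
  have hexpand (τ : ℝ) : ∑ q ∈ s, a q * (τ * a q - a₀ q) =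
      τ * ∑ q ∈ s, a q ^ 2 - ∑ q ∈ s, a q * a₀ q := by
    rw [Finset.mul_sum, ← Finset.sum_sub_distrib]
    exact Finset.sum_congr rfl fun q _ => by ring
  by_cases h : ∑ q ∈ s, a q ^ 2 = 0
  · refine ⟨0, Finset.sum_eq_zero fun q hq => ?_⟩
    rw [sq_eq_zero_iff.1 ((Finset.sum_eq_zero_iff_of_nonneg fun p _ => sq_nonneg (a p)).1 h q hq),
      zero_mul]
  · exact ⟨(∑ q ∈ s, a q * a₀ q) / ∑ q ∈ s, a q ^ 2, by
      rw [hexpand, div_mul_cancel₀ _ h, sub_self]⟩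

-- Projecting the left factor `a₀` on `a` in every block makes the two outer products orthogonal.
theorem exists_orthogonal_blockOuter_sub [Finite κ] {a b a₀ b₀ : ι × κ → ℝ}
    (ha : ∀ q ∉ J, a q = 0) (hb : ∀ q ∉ J, b q = 0)
    (ha₀ : ∀ q ∉ J, a₀ q = 0) (hb₀ : ∀ q ∉ J, b₀ q = 0) :
    ∃ y x' : ι × κ → ℝ, (∀ q ∉ J, y q = 0) ∧ (∀ q ∉ J, x' q = 0) ∧
      blockOuter c a b - blockOuter c a₀ b₀ = blockOuter c a y + blockOuter c x' b₀ ∧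
      frobInner (blockOuter c a y) (blockOuter c x' b₀) = 0 := by
  classical
  have := Fintype.ofFinite κ
  choose τ hτ using fun e : κ × κ =>
    exists_sum_mul_sub_mul_eq_zero {q | blockOf c q = e} a a₀
  refine ⟨fun q => b q - τ (blockOf c q).swap * b₀ q, fun q => τ (blockOf c q) * a q - a₀ q,
    fun q hq => by simp only [hb q hq, hb₀ q hq, mul_zero, sub_zero],
    fun q hq => by simp only [ha q hq, ha₀ q hq, mul_zero, sub_zero], ?_, ?_⟩
  · ext i j
    simp only [blockOuter, blockOf, Prod.swap, Matrix.sub_apply, Matrix.add_apply, Matrix.of_apply]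
    ring
  · rw [frobInner_blockOuter_blockOuter]
    refine Finset.sum_eq_zero fun e _ => ?_
    have hleft : ∑ q with blockOf c q = e, a q * (τ (blockOf c q) * a q - a₀ q) = 0 :=
      (Finset.sum_congr rfl fun q hq => by rw [(Finset.mem_filter.1 hq).2]).trans (hτ e)
    rw [hleft, zero_mul]

variable [Fintype κ] [DecidableEq κ]

theorem LatticeBounded.frobInner_sub_le [DecidableEq ι] {E : Matrix ι ι ℝ} {B : ℝ}
    (hE : LatticeBounded c J E B) (hB : 0 ≤ B) {T T₀ : Matrix ι ι ℝ} (hT : T ∈ rankOneClass c J)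
    (hT₀ : T₀ ∈ rankOneClass c J) : frobInner E (T - T₀) ≤ 8 * B * √(frobSq (T - T₀)) := by
  obtain ⟨a, b, ha, hb, rfl⟩ := exists_eq_blockOuter hT
  obtain ⟨a₀, b₀, ha₀, hb₀, rfl⟩ := exists_eq_blockOuter hT₀
  obtain ⟨y, x', hy, hx', hsub, horth⟩ := exists_orthogonal_blockOuter_sub (c := c) ha hb ha₀ hb₀
  have hpyth : frobSq (blockOuter c a y + blockOuter c x' b₀) =
      frobSq (blockOuter c a y) + frobSq (blockOuter c x' b₀) := by
    rw [frobSq_add, horth, mul_zero, add_zero]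
  have hleft : √(frobSq (blockOuter c a y)) ≤ √(frobSq (blockOuter c a y + blockOuter c x' b₀)) :=
    Real.sqrt_le_sqrt (hpyth ▸ le_add_of_nonneg_right (frobSq_nonneg _))
  have hright :
      √(frobSq (blockOuter c x' b₀)) ≤ √(frobSq (blockOuter c a y + blockOuter c x' b₀)) :=
    Real.sqrt_le_sqrt (hpyth ▸ le_add_of_nonneg_left (frobSq_nonneg _))
  rw [hsub, frobInner_add_right]
  calc frobInner E (blockOuter c a y) + frobInner E (blockOuter c x' b₀)
      ≤ 4 * B * √(frobSq (blockOuter c a y)) + 4 * B * √(frobSq (blockOuter c x' b₀)) :=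
        add_le_add (hE.frobInner_blockOuter_le hB ha hy) (hE.frobInner_blockOuter_le hB hx' hb₀)
    _ ≤ 4 * B * √(frobSq (blockOuter c a y + blockOuter c x' b₀)) +
          4 * B * √(frobSq (blockOuter c a y + blockOuter c x' b₀)) := by gcongr
    _ = 8 * B * √(frobSq (blockOuter c a y + blockOuter c x' b₀)) := by ring

end RankOneClass

section SubsetCost

/-- The cost `j ln (N e / j)` of a subset with `j` elements of a set with `N` elements; it is an
upper bound for the logarithm of the number of these subsets. The value at `j = 0` is zero. -/
def subsetCost (N j : ℝ) : ℝ := j * Real.log (N * Real.exp 1 / j)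

theorem subsetCost_zero (N : ℝ) : subsetCost N 0 = 0 := zero_mul _

theorem one_le_log_mul_exp_div {N j : ℝ} (hj : 0 < j) (hjN : j ≤ N) :
    1 ≤ Real.log (N * Real.exp 1 / j) := by
  have hN : 0 < N := hj.trans_le hjN
  rw [Real.le_log_iff_exp_le (by positivity), le_div_iff₀ hj, mul_comm]
  gcongr

theorem le_subsetCost {N j : ℝ} (hj : 0 ≤ j) (hjN : j ≤ N) : j ≤ subsetCost N j := by
  rcases hj.eq_or_lt with rfl | h0
  · exact (subsetCost_zero N).ge
  · exact le_mul_of_one_le_right hj (one_le_log_mul_exp_div h0 hjN)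

theorem subsetCost_le_tangent {N j ρ : ℝ} (hj : 0 ≤ j) (hjN : j ≤ N) (hρ : 0 < ρ) :
    subsetCost N j ≤ j * Real.log (Real.exp 1 / ρ) + (N * ρ - j) := by
  rcases hj.eq_or_lt with rfl | h0
  · rw [subsetCost_zero]
    linarith [mul_nonneg hjN hρ.le]
  have hN : 0 < N := h0.trans_le hjN
  have hsplit : N * Real.exp 1 / j = Real.exp 1 / ρ * (N * ρ / j) := by field_simp
  have hlog : j * Real.log (N * ρ / j) ≤ N * ρ - j :=
    (mul_le_mul_of_nonneg_left (Real.log_le_sub_one_of_pos (by positivity)) hj).trans_eq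
      (by field_simp)
  rw [subsetCost, hsplit, Real.log_mul (by positivity) (by positivity), mul_add]
  linarith

theorem subsetCost_mono {N j j' : ℝ} (hj : 0 ≤ j) (h : j ≤ j') (hN : j' ≤ N) :
    subsetCost N j ≤ subsetCost N j' := by
  rcases (hj.trans h).eq_or_lt with h0 | h0
  · rw [le_antisymm h (h0 ▸ hj)]
  have hN0 : 0 < N := h0.trans_le hN
  have htangent := subsetCost_le_tangent hj (h.trans hN) (div_pos h0 hN0)
  rw [mul_div_cancel₀ _ hN0.ne', div_div_eq_mul_div, mul_comm (Real.exp 1)] at htangent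
  have hslope := mul_nonneg (sub_nonneg.2 h) (sub_nonneg.2 (one_le_log_mul_exp_div h0 hN))
  rw [subsetCost.eq_def N j']
  linarith

theorem sum_subsetCost_le {α : Type*} (s : Finset α) {N j : α → ℝ} (hj : ∀ i ∈ s, 0 ≤ j i)
    (hjN : ∀ i ∈ s, j i ≤ N i) :
    ∑ i ∈ s, subsetCost (N i) (j i) ≤ subsetCost (∑ i ∈ s, N i) (∑ i ∈ s, j i) := by
  rcases (Finset.sum_nonneg hj).eq_or_lt with h0 | h0
  · rw [← h0, subsetCost_zero]
    refine (Finset.sum_eq_zero fun i hi => ?_).le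
    rw [(Finset.sum_eq_zero_iff_of_nonneg hj).1 h0.symm i hi, subsetCost_zero]
  set N' := ∑ i ∈ s, N i
  set j' := ∑ i ∈ s, j i
  have hN' : 0 < N' := h0.trans_le (Finset.sum_le_sum hjN)
  calc ∑ i ∈ s, subsetCost (N i) (j i)
      ≤ ∑ i ∈ s, (j i * Real.log (Real.exp 1 / (j' / N')) + (N i * (j' / N') - j i)) :=
        Finset.sum_le_sum fun i hi =>
          subsetCost_le_tangent (hj i hi) (hjN i hi) (div_pos h0 hN')
    _ = j' * Real.log (Real.exp 1 / (j' / N')) + (N' * (j' / N') - j') := by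
        rw [Finset.sum_add_distrib, Finset.sum_sub_distrib, ← Finset.sum_mul, ← Finset.sum_mul]
    _ = subsetCost N' j' := by
        rw [mul_div_cancel₀ _ hN'.ne', sub_self, add_zero, div_div_eq_mul_div,
          mul_comm (Real.exp 1), subsetCost]

theorem choose_le_exp_subsetCost (N j : ℕ) : (N.choose j : ℝ) ≤ Real.exp (subsetCost N j) := by
  rcases Nat.eq_zero_or_pos j with rfl | hj
  · simp [subsetCost]
  rcases Nat.lt_or_ge N j with h | h
  · simpa [Nat.choose_eq_zero_of_lt h] using (Real.exp_pos _).le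
  have hj0 : (0 : ℝ) < j := Nat.cast_pos.2 hj
  have hN0 : (0 : ℝ) < N := Nat.cast_pos.2 (hj.trans_le h)
  rw [subsetCost, Real.exp_nat_mul, Real.exp_log (by positivity), div_pow, mul_pow,
    ← Real.exp_nat_mul, mul_one, le_div_iff₀ (by positivity)]
  calc (N.choose j : ℝ) * (j : ℝ) ^ j ≤ (N : ℝ) ^ j / j.factorial * (j : ℝ) ^ j := by
        gcongr
        exact Nat.choose_le_pow_div j N
    _ = (N : ℝ) ^ j * ((j : ℝ) ^ j / j.factorial) := by ring
    _ ≤ (N : ℝ) ^ j * Real.exp j := by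
        gcongr
        exact Real.pow_div_factorial_le_exp _ hj0.le j

theorem choose_mul_exp_neg_subsetCost_le {N j : ℕ} (hj : j ≤ N) {θ : ℝ} (hθ : 1 ≤ θ) :
    N.choose j * Real.exp (-(θ * subsetCost N j)) ≤ Real.exp (1 - θ) ^ j := by
  calc N.choose j * Real.exp (-(θ * subsetCost N j))
      ≤ Real.exp (subsetCost N j) * Real.exp (-(θ * subsetCost N j)) := by
        gcongr
        exact choose_le_exp_subsetCost N j
    _ = Real.exp (-((θ - 1) * subsetCost N j)) := by
        rw [← Real.exp_add]
        ring_nf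
    _ ≤ Real.exp (-((θ - 1) * j)) := by
        have hcost : (j : ℝ) ≤ subsetCost N j :=
          le_subsetCost j.cast_nonneg (Nat.cast_le.2 hj)
        gcongr
    _ = Real.exp (1 - θ) ^ j := by
        rw [← Real.exp_nat_mul]
        ring_nf

theorem sum_exp_neg_subsetCost_le (α : Type*) [Fintype α] {θ : ℝ} (hθ : 1 < θ) :
    ∑ S : Finset α, Real.exp (-(θ * subsetCost (Fintype.card α) S.card)) ≤
      (1 - Real.exp (1 - θ))⁻¹ := by
  have hr : Real.exp (1 - θ) < 1 := Real.exp_lt_one_iff.2 (sub_neg.2 hθ)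
  rw [← Finset.powerset_univ, Finset.sum_powerset_apply_card
    (fun j => Real.exp (-(θ * subsetCost (Fintype.card α) j))), Finset.card_univ]
  calc ∑ j ∈ Finset.range (Fintype.card α + 1),
        (Fintype.card α).choose j • Real.exp (-(θ * subsetCost (Fintype.card α) j))
      ≤ ∑ j ∈ Finset.range (Fintype.card α + 1), Real.exp (1 - θ) ^ j :=
        Finset.sum_le_sum fun j hj => (nsmul_eq_mul _ _).trans_le
          (choose_mul_exp_neg_subsetCost_le (Finset.mem_range_succ_iff.1 hj) hθ.le)
    _ ≤ ∑' j, Real.exp (1 - θ) ^ j :=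
        (summable_geometric_of_lt_one (Real.exp_pos _).le hr).sum_le_tsum _
          fun _ _ => by positivity
    _ = (1 - Real.exp (1 - θ))⁻¹ := tsum_geometric_of_lt_one (Real.exp_pos _).le hr

end SubsetCost

section Complexity

variable {n K : ℕ} {c : Fin n → Fin K} {J : Finset (Fin n × Fin K)}

/-- The part of the penalty that is multiplied by `β₁`: the cost of the sparsity set, counted
block by block or as a whole. -/
def suppCost (a : PenaltyKind) (c : Fin n → Fin K) (J : Finset (Fin n × Fin K)) : ℝ :=
  match a with
  | .separable => ∑ k, ∑ l, subsetCost (commSize c k) (suppSet c J k l).card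
  | .nonseparable => subsetCost (n * K) J.card

/-- The part of `Pen^{(0)}` that is multiplied by `β₂`. -/
def sizeCost (a : PenaltyKind) (c : Fin n → Fin K) : ℝ :=
  match a with
  | .separable => K * ∑ k, Real.log (commSize c k)
  | .nonseparable => 2 * Real.log n

/-- The part of `Pen^{(1)}` that is multiplied by `β₂`: it pays for the choice of the clustering. -/
def clusterCost (n K : ℕ) : ℝ := n * Real.log K + Real.log n

theorem pen_eq (a : PenaltyKind) (β₁ β₂ : ℝ) (c : Fin n → Fin K) (J : Finset (Fin n × Fin K)) :
    pen a β₁ β₂ c J = β₁ * suppCost a c J + β₂ * (sizeCost a c + clusterCost n K) := by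
  cases a <;> simp only [pen, suppCost, sizeCost, clusterCost, penZeroSep, penZeroNonsep, penOne,
    subsetCost] <;> ring

theorem clusterCost_nonneg (n K : ℕ) : 0 ≤ clusterCost n K :=
  add_nonneg (mul_nonneg n.cast_nonneg (Real.log_natCast_nonneg K)) (Real.log_natCast_nonneg n)

theorem sizeCost_nonneg (a : PenaltyKind) (c : Fin n → Fin K) : 0 ≤ sizeCost a c := by
  cases a
  · exact mul_nonneg K.cast_nonneg (Finset.sum_nonneg fun k _ => Real.log_natCast_nonneg _)
  · exact mul_nonneg zero_le_two (Real.log_natCast_nonneg n)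

theorem card_suppSet_le (c : Fin n → Fin K) (J : Finset (Fin n × Fin K)) (k l : Fin K) :
    ((suppSet c J k l).card : ℝ) ≤ commSize c k :=
  Nat.cast_le.2 (Finset.card_le_univ _)

theorem card_supp_le (J : Finset (Fin n × Fin K)) : (J.card : ℝ) ≤ n * K := by
  have h := Finset.card_le_univ J
  rw [Fintype.card_prod, Fintype.card_fin, Fintype.card_fin] at h
  exact_mod_cast h

theorem card_suppSet (c : Fin n → Fin K) (J : Finset (Fin n × Fin K)) (k l : Fin K) :
    (suppSet c J k l).card = (blockSupp c J (k, l)).card := by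
  refine Finset.card_bij (fun i _ => (i.1, l)) (fun i hi => ?_)
    (fun i _ j _ h => Subtype.ext (Prod.ext_iff.1 h).1) ?_
  · simpa [blockOf, i.2, suppSet] using hi
  · rintro ⟨i, l'⟩ hq
    obtain ⟨hJ, rfl, rfl⟩ : (i, l') ∈ J ∧ c i = k ∧ l' = l := by simpa [blockOf] using hq
    exact ⟨⟨i, rfl⟩, by simpa [suppSet] using hJ, rfl⟩

theorem sum_card_suppSet (c : Fin n → Fin K) (J : Finset (Fin n × Fin K)) :
    ∑ k, ∑ l, ((suppSet c J k l).card : ℝ) = J.card := by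
  rw [Finset.card_eq_sum_card_fiberwise (f := blockOf c) (t := Finset.univ) fun _ _ => by simp,
    Fintype.sum_prod_type]
  simp only [card_suppSet, Nat.cast_sum]

theorem card_le_suppCost (a : PenaltyKind) (c : Fin n → Fin K) (J : Finset (Fin n × Fin K)) :
    (J.card : ℝ) ≤ suppCost a c J := by
  cases a
  · rw [← sum_card_suppSet c]
    exact Finset.sum_le_sum fun k _ => Finset.sum_le_sum fun l _ =>
      le_subsetCost (Nat.cast_nonneg _) (card_suppSet_le c J k l)
  · exact le_subsetCost (Nat.cast_nonneg _) (card_supp_le J)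

theorem suppCost_nonneg (a : PenaltyKind) (c : Fin n → Fin K) (J : Finset (Fin n × Fin K)) :
    0 ≤ suppCost a c J :=
  (Nat.cast_nonneg _).trans (card_le_suppCost a c J)

theorem suppCost_mono (a : PenaltyKind) (c : Fin n → Fin K) {J J' : Finset (Fin n × Fin K)}
    (h : J ⊆ J') : suppCost a c J ≤ suppCost a c J' := by
  cases a
  · refine Finset.sum_le_sum fun k _ => Finset.sum_le_sum fun l _ =>
      subsetCost_mono (Nat.cast_nonneg _) (Nat.cast_le.2 (Finset.card_le_card ?_))
        (card_suppSet_le c J' k l)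
    exact Finset.monotone_filter_right _ fun i _ hi => h hi
  · exact subsetCost_mono (Nat.cast_nonneg _) (Nat.cast_le.2 (Finset.card_le_card h))
      (card_supp_le J')

theorem commSize_pos (hc : Function.Surjective c) (k : Fin K) : 0 < commSize c k :=
  have ⟨i, hi⟩ := hc k
  Fintype.card_pos_iff.2 ⟨⟨i, hi⟩⟩

end Complexity

section ReducedSupports

variable {n K : ℕ} {c : Fin n → Fin K}

/-- The communities `k` and `l` consist of one node each, so that the block `(k, l)` has a single
entry. The separable penalty does not pay for the choice of the support of such a block. -/
abbrev SinglePair (c : Fin n → Fin K) (k l : Fin K) : Prop := commSize c k = 1 ∧ commSize c l = 1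

/-- The positions of `J` outside the blocks with a single entry. -/
def reducedSupp (c : Fin n → Fin K) (J : Finset (Fin n × Fin K)) : Finset (Fin n × Fin K) :=
  {q ∈ J | ¬SinglePair c (c q.1) q.2}

/-- The sparsity sets that avoid the blocks with a single entry. -/
def reducedSupps (c : Fin n → Fin K) : Finset (Finset (Fin n × Fin K)) :=
  {J | ∀ q ∈ J, ¬SinglePair c (c q.1) q.2}

theorem reducedSupp_mem_reducedSupps (c : Fin n → Fin K) (J : Finset (Fin n × Fin K)) :
    reducedSupp c J ∈ reducedSupps c :=
  Finset.mem_filter.2 ⟨Finset.mem_univ _, fun _ hq => (Finset.mem_filter.1 hq).2⟩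

theorem reducedSupp_subset (c : Fin n → Fin K) (J : Finset (Fin n × Fin K)) :
    reducedSupp c J ⊆ J :=
  Finset.filter_subset _ _

theorem sum_prod_comp_le_prod_sum {α β : Type*} [Fintype β] {X : β → Type*} {s : Finset α}
    {f : α → ∀ b, X b} (hf : Function.Injective f) {t : ∀ b, Finset (X b)}
    (hft : ∀ i ∈ s, ∀ b, f i b ∈ t b) {w : ∀ b, X b → ℝ} (hw : ∀ b S, 0 ≤ w b S) :
    ∑ i ∈ s, ∏ b, w b (f i b) ≤ ∏ b, ∑ S ∈ t b, w b S := by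
  classical
  rw [Finset.prod_univ_sum, ← Finset.sum_image (f := fun g => ∏ b, w b (g b)) hf.injOn]
  refine Finset.sum_le_sum_of_subset_of_nonneg (fun g hg => ?_) fun g _ _ =>
    Finset.prod_nonneg fun b _ => hw b _
  obtain ⟨i, hi, rfl⟩ := Finset.mem_image.1 hg
  exact Fintype.mem_piFinset.2 (hft i hi)

theorem suppSet_injective (c : Fin n → Fin K) :
    Function.Injective fun (J : Finset (Fin n × Fin K)) (b : Fin K × Fin K) =>
      suppSet c J b.1 b.2 := by
  intro J J' h
  ext ⟨i, l⟩
  have hblock : suppSet c J (c i) l = suppSet c J' (c i) l := congrFun h (c i, l)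
  simpa [suppSet] using Finset.ext_iff.1 hblock ⟨i, rfl⟩

/-- The factor `exp (-θ |S| ln (n_k e / |S|)) / (n_k n_l)` that a support `S` in the block
`b = (k, l)` contributes to the weight of a sparsity set. -/
def blockWeight (c : Fin n → Fin K) (θ : ℝ) (b : Fin K × Fin K) (S : Finset (Community c b.1)) :
    ℝ :=
  Real.exp (-(θ * subsetCost (commSize c b.1) S.card)) *
    ((commSize c b.1 : ℝ) * commSize c b.2)⁻¹

theorem blockWeight_nonneg (c : Fin n → Fin K) (θ : ℝ) (b : Fin K × Fin K)
    (S : Finset (Community c b.1)) : 0 ≤ blockWeight c θ b S := by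
  unfold blockWeight
  positivity

theorem blockWeight_eq_exp (hc : Function.Surjective c) (θ : ℝ) (b : Fin K × Fin K)
    (S : Finset (Community c b.1)) :
    blockWeight c θ b S = Real.exp (-(θ * subsetCost (commSize c b.1) S.card +
      (Real.log (commSize c b.1) + Real.log (commSize c b.2)))) := by
  have hpos (k : Fin K) : (0 : ℝ) < commSize c k := Nat.cast_pos.2 (commSize_pos hc k)
  rw [blockWeight, neg_add, Real.exp_add, Real.exp_neg (_ + _), Real.exp_add,
    Real.exp_log (hpos _), Real.exp_log (hpos _)]

theorem exp_neg_separable_cost_eq_prod (hc : Function.Surjective c) (θ : ℝ)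
    (J : Finset (Fin n × Fin K)) :
    Real.exp (-(θ * suppCost .separable c J + 2 * sizeCost .separable c)) =
      ∏ b : Fin K × Fin K, blockWeight c θ b (suppSet c J b.1 b.2) := by
  simp only [blockWeight_eq_exp hc]
  rw [← Real.exp_sum, Finset.sum_neg_distrib, Finset.sum_add_distrib, Finset.sum_add_distrib,
    ← Finset.mul_sum]
  simp only [Fintype.sum_prod_type, suppCost, sizeCost, Finset.sum_const, Finset.card_univ,
    Fintype.card_fin, nsmul_eq_mul, ← Finset.mul_sum]
  ring_nf

theorem exp_one_sub_le_half {θ : ℝ} (hθ : 2 ≤ θ) : Real.exp (1 - θ) ≤ 1 / 2 := by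
  rw [← neg_sub, Real.exp_neg, one_div]
  exact inv_anti₀ two_pos (by linarith [Real.add_one_le_exp (θ - 1)])

theorem sum_blockWeight_le_one (hc : Function.Surjective c) {θ : ℝ} (hθ : 2 ≤ θ)
    {b : Fin K × Fin K} (hb : ¬SinglePair c b.1 b.2) : ∑ S, blockWeight c θ b S ≤ 1 := by
  have hsize : (2 : ℝ) ≤ (commSize c b.1 : ℝ) * commSize c b.2 := by
    have h₁ := commSize_pos hc b.1
    have h₂ := commSize_pos hc b.2
    have hprod : 2 ≤ commSize c b.1 * commSize c b.2 := by
      by_contra! h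
      exact hb ⟨by nlinarith, by nlinarith⟩
    exact_mod_cast hprod
  have hsum : ∑ S : Finset (Community c b.1),
      Real.exp (-(θ * subsetCost (commSize c b.1) S.card)) ≤ 2 := by
    refine (sum_exp_neg_subsetCost_le _ (by linarith)).trans ?_
    have hhalf := exp_one_sub_le_half hθ
    rw [inv_le_comm₀ (by linarith) two_pos]
    linarith
  simp only [blockWeight]
  rw [← Finset.sum_mul, ← div_eq_mul_inv]
  exact div_le_one_of_le₀ (hsum.trans hsize) (by positivity)

theorem sum_exp_neg_separable_cost_le_one (hc : Function.Surjective c) {θ : ℝ} (hθ : 2 ≤ θ) :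
    ∑ J ∈ reducedSupps c,
      Real.exp (-(θ * suppCost .separable c J + 2 * sizeCost .separable c)) ≤ 1 := by
  let t (b : Fin K × Fin K) : Finset (Finset (Community c b.1)) :=
    if SinglePair c b.1 b.2 then {∅} else Finset.univ
  have hmem (J) (hJ : J ∈ reducedSupps c) (b : Fin K × Fin K) : suppSet c J b.1 b.2 ∈ t b := by
    simp only [t]
    split_ifs with hb
    · refine Finset.mem_singleton.2 (Finset.eq_empty_of_forall_notMem fun i hi => ?_)
      refine (Finset.mem_filter.1 hJ).2 (i.1, b.2) (Finset.mem_filter.1 hi).2 ?_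
      rwa [i.2]
    · exact Finset.mem_univ _
  simp only [exp_neg_separable_cost_eq_prod hc θ]
  refine (sum_prod_comp_le_prod_sum (suppSet_injective c) hmem (blockWeight_nonneg c θ)).trans
    (Finset.prod_le_one (fun b _ => Finset.sum_nonneg fun S _ => blockWeight_nonneg c θ b S)
      fun b _ => ?_)
  simp only [t]
  split_ifs with hb
  · simp [blockWeight, subsetCost_zero, hb.1, hb.2]
  · exact sum_blockWeight_le_one hc hθ hb

theorem sum_exp_neg_cost_le (a : PenaltyKind) (hc : Function.Surjective c) {θ : ℝ} (hθ : 2 ≤ θ) :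
    ∑ J ∈ reducedSupps c, Real.exp (-(θ * suppCost a c J + 2 * sizeCost a c)) ≤
      (1 - Real.exp (1 - θ))⁻¹ := by
  cases a
  · have hhalf := exp_one_sub_le_half hθ
    refine (sum_exp_neg_separable_cost_le_one hc hθ).trans ((one_le_inv₀ (by linarith)).2 ?_)
    linarith [Real.exp_pos (1 - θ)]
  · calc ∑ J ∈ reducedSupps c,
          Real.exp (-(θ * suppCost .nonseparable c J + 2 * sizeCost .nonseparable c))
        ≤ ∑ J : Finset (Fin n × Fin K), Real.exp (-(θ * suppCost .nonseparable c J)) := by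
          refine (Finset.sum_le_sum fun J _ => Real.exp_le_exp.2 (neg_le_neg ?_)).trans
            (Finset.sum_le_sum_of_subset_of_nonneg (Finset.subset_univ _)
              fun _ _ _ => (Real.exp_pos _).le)
          linarith [sizeCost_nonneg .nonseparable c]
      _ ≤ (1 - Real.exp (1 - θ))⁻¹ := by
          simpa only [suppCost, Fintype.card_prod, Fintype.card_fin, Nat.cast_mul]
            using sum_exp_neg_subsetCost_le (Fin n × Fin K) (θ := θ) (by linarith)

theorem inv_one_sub_exp_add_le_three :
    (1 - Real.exp (1 - 2))⁻¹ + (1 - Real.exp (1 - 3))⁻¹ ≤ (3 : ℝ) := by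
  have he : 2.7 < Real.exp 1 := by linarith [Real.exp_one_gt_d9]
  have h₁ : Real.exp (1 - 2) ≤ 2.7⁻¹ := by
    rw [show (1 - 2 : ℝ) = -1 by norm_num, Real.exp_neg]
    exact inv_anti₀ (by norm_num) he.le
  have h₂ : Real.exp (1 - 3) ≤ 2.7⁻¹ ^ 2 := by
    rw [show (1 - 3 : ℝ) = (2 : ℕ) * (1 - 2) by norm_num, Real.exp_nat_mul]
    exact pow_le_pow_left₀ (Real.exp_pos _).le h₁ 2
  calc (1 - Real.exp (1 - 2))⁻¹ + (1 - Real.exp (1 - 3))⁻¹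
      ≤ (1 - 2.7⁻¹)⁻¹ + (1 - 2.7⁻¹ ^ 2)⁻¹ :=
        add_le_add (inv_anti₀ (by norm_num) (by linarith))
          (inv_anti₀ (by norm_num) (by linarith))
    _ ≤ 3 := by norm_num

end ReducedSupports

section Feasible

theorem mul_eq_mul_of_rank_le_one {m m' : Type*} [Fintype m'] {M : Matrix m m' ℝ}
    (h : M.rank ≤ 1) (i i' : m) (j j' : m') : M i j * M i' j' = M i j' * M i' j := by
  classical
  obtain ⟨v, hv⟩ := finrank_le_one_iff.1
    (show Module.finrank ℝ (LinearMap.range M.mulVecLin) ≤ 1 from h)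
  have hcol (j : m') : ∃ t : ℝ, ∀ i, M i j = t * v.1 i := by
    obtain ⟨t, ht⟩ := hv ⟨M.mulVecLin (Pi.single j 1), LinearMap.mem_range_self _ _⟩
    exact ⟨t, fun i => by simpa using (congrFun (congrArg Subtype.val ht) i).symm⟩
  obtain ⟨t, ht⟩ := hcol j
  obtain ⟨t', ht'⟩ := hcol j'
  rw [ht, ht, ht', ht']
  ring

variable {n K : ℕ}

namespace Feasible

variable (s : Feasible n)

theorem estimator_eq_block {i j : Fin n} {k l : Fin s.K} (hi : s.c i = k) (hj : s.c j = l) :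
    s.estimator i j = block s.Theta k l ⟨i, hi⟩ ⟨j, hj⟩ := by
  subst hi hj
  rfl

theorem estimator_ne_zero_iff (i j : Fin n) :
    s.estimator i j ≠ 0 ↔ (i, s.c j) ∈ s.J ∧ (j, s.c i) ∈ s.J := by
  rw [s.estimator_eq_block rfl rfl, s.supp_eq]
  simp [suppSet]

theorem estimator_mem : s.estimator ∈ rankOneClass s.c s.J := by
  refine ⟨fun i j i' j' hi hj => ?_, fun i j h => ?_⟩
  · rw [s.estimator_eq_block hi hj, s.estimator_eq_block (i := i') rfl (j := j') rfl,
      s.estimator_eq_block hi (j := j') rfl, s.estimator_eq_block (i := i') rfl hj]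
    exact mul_eq_mul_of_rank_le_one (s.rank_le_one _ _) _ _ _ _
  · by_contra h0
    exact h ((s.estimator_ne_zero_iff i j).1 h0)

end Feasible

theorem sum_rearranged (c : Fin n → Fin K) (f : Fin n → ℝ) :
    ∑ k, ∑ i : Community c k, f i.1 = ∑ i, f i := by
  rw [← (perm c).sum_comp f, Fintype.sum_sigma]
  rfl

theorem objective_eq (a : PenaltyKind) (β₁ β₂ : ℝ) (A : Matrix (Fin n) (Fin n) ℝ)
    (s : Feasible n) :
    objective a β₁ β₂ A s = frobSq (A - s.estimator) + pen a β₁ β₂ s.c s.J := by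
  have hblocks : frobSq (A - s.estimator) =
      ∑ k, ∑ i : Community s.c k, ∑ l, ∑ j : Community s.c l, (A - s.estimator) i j ^ 2 := by
    rw [frobSq, ← sum_rearranged s.c]
    exact Finset.sum_congr rfl fun k _ => Finset.sum_congr rfl fun i _ =>
      (sum_rearranged s.c fun j => (A - s.estimator) i j ^ 2).symm
  rw [objective, hblocks]
  congr 1
  refine Finset.sum_congr rfl fun k _ => ?_
  rw [Finset.sum_comm]
  refine Finset.sum_congr rfl fun l _ => Finset.sum_congr rfl fun i _ =>
    Finset.sum_congr rfl fun j _ => ?_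
  rw [Matrix.sub_apply, Matrix.sub_apply, s.estimator_eq_block i.2 j.2]
  rfl

theorem frobSq_sub_add_pen_le {a : PenaltyKind} {β₁ β₂ : ℝ} {A : Matrix (Fin n) (Fin n) ℝ}
    {s s₀ : Feasible n} (h : objective a β₁ β₂ A s ≤ objective a β₁ β₂ A s₀) :
    frobSq (s.estimator - s₀.estimator) + pen a β₁ β₂ s.c s.J ≤
      2 * frobInner (A - s₀.estimator) (s.estimator - s₀.estimator) +
        pen a β₁ β₂ s₀.c s₀.J := by
  rw [objective_eq, objective_eq, ← sub_sub_sub_cancel_right A s.estimator s₀.estimator,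
    frobSq_sub] at h
  linarith

/-- The pair `(c, Λ)` of the model as a feasible point, with the estimator `probMatrix c Λ`. -/
def trueFeasible (c : Fin n → Fin K) (hc : Function.Surjective c)
    (Lam : Matrix (Fin n) (Fin K) ℝ) : Feasible n where
  K := K
  c := c
  surj := hc
  J := trueSupp Lam
  Theta := rearrange c (probMatrix c Lam)
  rank_le_one k l := by
    have hblock : block (rearrange c (probMatrix c Lam)) k l =
        Matrix.vecMulVec (fun i : Community c k => Lam i.1 l)
          (fun j : Community c l => Lam j.1 k) := by
      ext ⟨i, rfl⟩ ⟨j, rfl⟩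
      rfl
    exact hblock ▸ Matrix.rank_vecMulVec_le _ _
  supp_eq k l := by
    rintro ⟨i, rfl⟩ ⟨j, rfl⟩
    change Lam i (c j) * Lam j (c i) ≠ 0 ↔ _
    simp [suppSet, trueSupp]

end Feasible

section SinglePairs

variable {n K : ℕ} {c : Fin n → Fin K} {J : Finset (Fin n × Fin K)}
  {T P E : Matrix (Fin n) (Fin n) ℝ}

/-- The matrix `T` with the blocks that have a single entry set to zero. -/
def dropSingles (c : Fin n → Fin K) (T : Matrix (Fin n) (Fin n) ℝ) : Matrix (Fin n) (Fin n) ℝ :=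
  Matrix.of fun i j => if SinglePair c (c i) (c j) then 0 else T i j

theorem dropSingles_mem (hT : T ∈ rankOneClass c J) :
    dropSingles c T ∈ rankOneClass c (reducedSupp c J) := by
  refine ⟨fun i j i' j' hi hj => ?_, fun i j h => ?_⟩
  · simp only [dropSingles, Matrix.of_apply, ← hi, ← hj]
    split_ifs
    · rfl
    · exact hT.1 i j i' j' hi hj
  · simp only [dropSingles, Matrix.of_apply, ite_eq_left_iff]
    refine fun hs => hT.2 i j fun hJ => h ?_
    simp only [reducedSupp, Finset.mem_filter]
    exact ⟨⟨hJ.1, hs⟩, hJ.2, fun hs' => hs hs'.symm⟩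

theorem eq_of_commSize_eq_one {i j : Fin n} (h : commSize c (c i) = 1) (hij : c i = c j) :
    i = j := by
  have := (Fintype.card_le_one_iff_subsingleton (α := Community c (c i))).1 h.le
  exact congrArg Subtype.val (Subsingleton.elim (⟨i, rfl⟩ : Community c (c i)) ⟨j, hij.symm⟩)

-- A nonzero entry `(i, j)` that forms a block on its own is determined by the position `(i, c j)`,
-- which lies in `J`.
theorem sum_singles_le_card (hT : T ∈ rankOneClass c J) :
    ∑ i, ∑ j, (if SinglePair c (c i) (c j) ∧ T i j ≠ 0 then (1 : ℝ) else 0) ≤ J.card := by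
  rw [← Fintype.sum_prod_type' (f := fun i j =>
    if SinglePair c (c i) (c j) ∧ T i j ≠ 0 then (1 : ℝ) else 0), Finset.sum_boole]
  refine Nat.cast_le.2 (Finset.card_le_card_of_injOn (fun p => (p.1, c p.2)) ?_ ?_)
  · intro p hp
    by_contra h
    exact (Finset.mem_filter.1 hp).2.2 (hT.2 _ _ fun hJ => h hJ.1)
  · intro p hp q _ h
    simp only [Prod.mk.injEq] at h
    exact Prod.ext h.1 (eq_of_commSize_eq_one (Finset.mem_filter.1 hp).2.1.2 h.2)

theorem sum_sum_le_add_mul_card (hT : T ∈ rankOneClass c J) {f g : Fin n → Fin n → ℝ} {C : ℝ}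
    (hC : 0 ≤ C) (hle : ∀ i j, (SinglePair c (c i) (c j) → T i j = 0) → f i j ≤ g i j)
    (hsingle : ∀ i j, SinglePair c (c i) (c j) → f i j ≤ g i j + C) :
    ∑ i, ∑ j, f i j ≤ ∑ i, ∑ j, g i j + C * J.card := by
  refine le_trans ?_ (add_le_add_right
    (mul_le_mul_of_nonneg_left (sum_singles_le_card hT) hC) _)
  simp only [Finset.mul_sum, ← Finset.sum_add_distrib]
  refine Finset.sum_le_sum fun i _ => Finset.sum_le_sum fun j _ => ?_
  split_ifs with h
  · simpa only [mul_one] using hsingle i j h.1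
  · simpa only [mul_zero, add_zero] using hle i j (by simpa using h)

theorem frobSq_dropSingles_sub_le (hT : T ∈ rankOneClass c J)
    (hP : ∀ i j, P i j ∈ Set.Icc (0 : ℝ) 1) :
    frobSq (dropSingles c T - P) ≤ frobSq (T - P) + J.card := by
  rw [← one_mul (J.card : ℝ)]
  refine sum_sum_le_add_mul_card hT zero_le_one (fun i j h => ?_) fun i j hs => ?_
  · simp only [dropSingles, Matrix.sub_apply, Matrix.of_apply]
    split_ifs with hs
    · rw [h hs]
    · rfl
  · simp only [dropSingles, Matrix.sub_apply, Matrix.of_apply, if_pos hs, zero_sub, neg_sq]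
    linarith [pow_le_one₀ (n := 2) (hP i j).1 (hP i j).2, sq_nonneg (T i j - P i j)]

theorem two_mul_frobInner_sub_dropSingles_le (hT : T ∈ rankOneClass c J)
    (hP : ∀ i j, P i j ∈ Set.Icc (0 : ℝ) 1) (hE : ∀ i j, |E i j| ≤ 1) {α : ℝ} (hα : 0 < α) :
    2 * frobInner E (T - dropSingles c T) ≤ α * frobSq (T - P) + (α⁻¹ + 2) * J.card := by
  simp only [frobInner, frobSq, Finset.mul_sum]
  refine sum_sum_le_add_mul_card hT (by positivity) (fun i j h => ?_) fun i j hs => ?_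
  · have hzero : T i j - (if SinglePair c (c i) (c j) then 0 else T i j) = 0 := by
      split_ifs with hs
      · rw [h hs, sub_self]
      · exact sub_self _
    simp only [dropSingles, Matrix.sub_apply, Matrix.of_apply, hzero, mul_zero]
    positivity
  · simp only [dropSingles, Matrix.sub_apply, Matrix.of_apply, if_pos hs, sub_zero]
    have hsq : α⁻¹ * E i j ^ 2 ≤ α⁻¹ :=
      mul_le_of_le_one_right (by positivity) ((sq_le_one_iff_abs_le_one _).2 (hE i j))
    have hEP : E i j * P i j ≤ 1 :=
      mul_le_one₀ (abs_le.1 (hE i j)).2 (hP i j).1 (hP i j).2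
    linarith [two_mul_le_add_mul_sq (a := T i j - P i j) (b := E i j) hα]

end SinglePairs

section Oracle

theorem frobSq_sub_le {m m' : Type} [Fintype m] [Fintype m'] (T T' P : Matrix m m' ℝ) :
    frobSq (T - T') ≤ 2 * frobSq (T - P) + 2 * frobSq (T' - P) := by
  have hsum := frobSq_nonneg (T - P + (T' - P))
  rw [frobSq_add] at hsum
  rw [← sub_sub_sub_cancel_right T T' P, frobSq_sub]
  linarith

/-- The noise `E` is controlled at the support `J`: its inner product with the approximation error
of `P` is within the deviation level `x₁`, its inner products with the lattice points are within
the deviation level `x₂`. -/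
structure NoiseControlled {ι κ : Type} [Fintype ι] [DecidableEq ι] [Fintype κ] [DecidableEq κ]
    (c : ι → κ) (J : Finset (ι × κ)) (P E : Matrix ι ι ℝ) (x₁ x₂ : ℝ) : Prop where
  frobInner_nearest_sub_le :
    frobInner E (nearest c J P - P) ≤ √(frobSq (nearest c J P - P)) * √x₁
  latticeBounded : LatticeBounded c J E √x₂

variable {n K : ℕ} {c : Fin n → Fin K} {J : Finset (Fin n × Fin K)}
  {T P E : Matrix (Fin n) (Fin n) ℝ} {α₁ α₂ : ℝ}

theorem two_mul_frobInner_le {x₁ x₂ : ℝ} (hE : ∀ i j, |E i j| ≤ 1)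
    (hP : ∀ i j, P i j ∈ Set.Icc (0 : ℝ) 1) (hT : T ∈ rankOneClass c J) (hx₁ : 0 ≤ x₁)
    (hx₂ : 0 ≤ x₂) (hα₁ : 0 < α₁) (hα₂ : 0 < α₂)
    (h : NoiseControlled c (reducedSupp c J) P E x₁ x₂) :
    2 * frobInner E (T - P) ≤ (α₁ + 5 * α₂) * frobSq (T - P) +
      (α₁ + 4 * α₂ + α₂⁻¹ + 2) * J.card + α₁⁻¹ * x₁ + α₂⁻¹ * (64 * x₂) := by
  set T₀ := nearest c (reducedSupp c J) P
  set U := dropSingles c T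
  have hU : frobSq (U - P) ≤ frobSq (T - P) + J.card := frobSq_dropSingles_sub_le hT hP
  have hT₀ : frobSq (T₀ - P) ≤ frobSq (T - P) + J.card :=
    (frobSq_nearest_sub_le (dropSingles_mem hT) P).trans hU
  have hUT₀ : frobSq (U - T₀) ≤ 4 * (frobSq (T - P) + J.card) :=
    (frobSq_sub_le U T₀ P).trans (by linarith)
  have hbias : 2 * frobInner E (T₀ - P) ≤ α₁ * (frobSq (T - P) + J.card) + α₁⁻¹ * x₁ := by
    have hamgm := two_mul_le_add_mul_sq (a := √(frobSq (T₀ - P))) (b := √x₁) hα₁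
    rw [Real.sq_sqrt (frobSq_nonneg _), Real.sq_sqrt hx₁] at hamgm
    linarith [h.frobInner_nearest_sub_le, mul_le_mul_of_nonneg_left hT₀ hα₁.le]
  have hlattice : 2 * frobInner E (U - T₀) ≤
      α₂ * (4 * (frobSq (T - P) + J.card)) + α₂⁻¹ * (64 * x₂) := by
    have hamgm := two_mul_le_add_mul_sq (a := √(frobSq (U - T₀))) (b := 8 * √x₂) hα₂
    rw [mul_pow, Real.sq_sqrt (frobSq_nonneg _), Real.sq_sqrt hx₂] at hamgm
    linarith [h.latticeBounded.frobInner_sub_le (Real.sqrt_nonneg x₂) (dropSingles_mem hT)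
      (nearest_mem c _ P), mul_le_mul_of_nonneg_left hUT₀ hα₂.le]
  have hsingles := two_mul_frobInner_sub_dropSingles_le hT hP hE hα₂
  have hsplit : T - P = (U - T₀) + (T - U) + (T₀ - P) := by abel
  rw [hsplit, frobInner_add_right, frobInner_add_right, ← hsplit]
  linarith

/-- The deviation level that makes a union bound over all clusterings `c` and all reduced sparsity
sets `J` sum up to a multiple of `exp (-t)`. -/
def deviationLevel (a : PenaltyKind) (θ t : ℝ) (c : Fin n → Fin K)
    (J : Finset (Fin n × Fin K)) : ℝ :=
  t + θ * suppCost a c J + 2 * (sizeCost a c + clusterCost n K)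

theorem deviationLevel_nonneg (a : PenaltyKind) {θ t : ℝ} (hθ : 0 ≤ θ) (ht : 0 ≤ t)
    (c : Fin n → Fin K) (J : Finset (Fin n × Fin K)) : 0 ≤ deviationLevel a θ t c J := by
  have hsupp := suppCost_nonneg a c J
  have hsize := sizeCost_nonneg a c
  have hcluster := clusterCost_nonneg n K
  unfold deviationLevel
  positivity

/-- The noise is controlled at the support `J` with the deviation levels of the union bound. The
summand `12 |J|` pays for the pairs of lattice points. -/
abbrev NoiseControlledAt (a : PenaltyKind) (t : ℝ) (c : Fin n → Fin K)
    (J : Finset (Fin n × Fin K)) (P E : Matrix (Fin n) (Fin n) ℝ) : Prop :=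
  NoiseControlled c J P E (deviationLevel a 2 t c J) (deviationLevel a 3 t c J + 12 * J.card)

theorem le_betaOne (α₁ : ℝ) (hα₂ : 0 < α₂) :
    962 * α₂⁻¹ + 2 * α₁⁻¹ ≤ betaOne 420 64 α₁ α₂ := by
  have heq : betaOne 420 64 α₁ α₂ = 968 * α₂⁻¹ + 968 + 2 * α₁⁻¹ := by
    rw [betaOne, mul_div_assoc, add_div, div_self hα₂.ne']
    ring
  linarith [inv_pos.2 hα₂]

theorem le_betaTwo (α₁ : ℝ) (hα₂ : 0 < α₂) :
    128 * α₂⁻¹ + 2 * α₁⁻¹ ≤ betaTwo 64 α₁ α₂ := by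
  have heq : betaTwo 64 α₁ α₂ = 128 * α₂⁻¹ + 128 + 2 * α₁⁻¹ := by
    rw [betaTwo, mul_div_assoc, add_div, div_self hα₂.ne']
    ring
  linarith

theorem NoiseControlled.two_mul_frobInner_le_pen {a : PenaltyKind} {t : ℝ}
    (h : NoiseControlledAt a t c (reducedSupp c J) P E) (hE : ∀ i j, |E i j| ≤ 1)
    (hP : ∀ i j, P i j ∈ Set.Icc (0 : ℝ) 1) (hT : T ∈ rankOneClass c J) (ht : 0 ≤ t)
    (hα₁ : 0 < α₁) (hα₂ : 0 < α₂) (hα : α₁ + 8 * α₂ < 1) :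
    2 * frobInner E (T - P) ≤ (α₁ + 5 * α₂) * frobSq (T - P) +
      pen a (betaOne 420 64 α₁ α₂) (betaTwo 64 α₁ α₂) c J + (1 / α₁ + 64 / α₂) * t := by
  have hbound := two_mul_frobInner_le hE hP hT (deviationLevel_nonneg a zero_le_two ht _ _)
    (add_nonneg (deviationLevel_nonneg a zero_le_three ht _ _) (by positivity)) hα₁ hα₂ h
  have hsub := suppCost_mono a c (reducedSupp_subset c J)
  have hcard := card_le_suppCost a c J
  have hcard' := card_le_suppCost a c (reducedSupp c J)
  rw [pen_eq]
  simp only [deviationLevel] at hbound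
  set G := suppCost a c J
  set F := sizeCost a c + clusterCost n K
  have hG : 0 ≤ G := suppCost_nonneg a c J
  have hF : 0 ≤ F := add_nonneg (sizeCost_nonneg a c) (clusterCost_nonneg n K)
  have hbias : α₁⁻¹ * (t + 2 * suppCost a c (reducedSupp c J) + 2 * F) ≤
      α₁⁻¹ * (t + 2 * G + 2 * F) := by gcongr
  have hlattice : α₂⁻¹ * (64 * (t + 3 * suppCost a c (reducedSupp c J) + 2 * F +
      12 * (reducedSupp c J).card)) ≤ α₂⁻¹ * (64 * (t + 15 * G + 2 * F)) :=
    mul_le_mul_of_nonneg_left (by linarith) (inv_nonneg.2 hα₂.le)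
  have hsupp : (α₁ + 4 * α₂ + α₂⁻¹ + 2) * J.card ≤ 2 * α₂⁻¹ * G := by
    have hα₂_inv : 8 ≤ α₂⁻¹ := (le_inv_comm₀ (by norm_num) hα₂).2 (by linarith)
    gcongr
    linarith
  have hβ₁ := mul_le_mul_of_nonneg_right (le_betaOne α₁ hα₂) hG
  have hβ₂ := mul_le_mul_of_nonneg_right (le_betaTwo α₁ hα₂) hF
  rw [one_div, div_eq_mul_inv]
  linarith

theorem frobSq_sub_le_of_noiseControlled {a : PenaltyKind} {t : ℝ}
    {A : Matrix (Fin n) (Fin n) ℝ} {s s₀ : Feasible n}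
    (hs : objective a (betaOne 420 64 α₁ α₂) (betaTwo 64 α₁ α₂) A s ≤
      objective a (betaOne 420 64 α₁ α₂) (betaTwo 64 α₁ α₂) A s₀)
    (h : NoiseControlledAt a t s.c (reducedSupp s.c s.J) s₀.estimator (A - s₀.estimator))
    (hA : ∀ i j, A i j ∈ Set.Icc (0 : ℝ) 1) (hP : ∀ i j, s₀.estimator i j ∈ Set.Icc (0 : ℝ) 1)
    (ht : 0 ≤ t) (hα₁ : 0 < α₁) (hα₂ : 0 < α₂) (hα : α₁ + 8 * α₂ < 1) :
    frobSq (s.estimator - s₀.estimator) ≤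
      hZero α₁ α₂ * pen a (betaOne 420 64 α₁ α₂) (betaTwo 64 α₁ α₂) s₀.c s₀.J +
        cTilde 64 α₁ α₂ * t := by
  have hE (i j : Fin n) : |(A - s₀.estimator) i j| ≤ 1 :=
    abs_sub_le_of_le_of_le (hA i j).1 (hA i j).2 (hP i j).1 (hP i j).2 |>.trans_eq (sub_zero 1)
  have hbasic := frobSq_sub_add_pen_le hs
  have hnoise := h.two_mul_frobInner_le_pen hE hP s.estimator_mem ht hα₁ hα₂ hα
  set D := frobSq (s.estimator - s₀.estimator)
  set pen₀ := pen a (betaOne 420 64 α₁ α₂) (betaTwo 64 α₁ α₂) s₀.c s₀.J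
  have hα₂D : 0 ≤ α₂ * D := mul_nonneg hα₂.le (frobSq_nonneg _)
  have hlevel : 0 ≤ (64 * 2 + 1 / α₁ + 64 / α₂) * t := by positivity
  have habsorb : D * (1 - α₁ - 8 * α₂) ≤ pen₀ + 2 * (64 + 1 / α₁ + 64 / α₂) * t := by linarith
  calc D ≤ (1 - α₁ - 8 * α₂)⁻¹ * (pen₀ + 2 * (64 + 1 / α₁ + 64 / α₂) * t) := by
        rwa [inv_mul_eq_div, le_div_iff₀ (by linarith)]
    _ = hZero α₁ α₂ * pen₀ + cTilde 64 α₁ α₂ * t := by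
        rw [cTilde, hZero]
        ring

end Oracle

section UnionBound

theorem sum_exp_neg_clusterCost_le_one (n : ℕ) :
    ∑ K ∈ Finset.Icc 1 n, ∑ _c : Fin n → Fin K, Real.exp (-clusterCost n K) ≤ 1 := by
  have hterm (K : ℕ) (hK : K ∈ Finset.Icc 1 n) :
      ∑ _c : Fin n → Fin K, Real.exp (-clusterCost n K) = (n : ℝ)⁻¹ := by
    have ⟨hK1, hKn⟩ := Finset.mem_Icc.1 hK
    have hK0 : (0 : ℝ) < K := Nat.cast_pos.2 hK1
    have hn0 : (0 : ℝ) < n := Nat.cast_pos.2 (hK1.trans hKn)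
    rw [Finset.sum_const, Finset.card_univ, Fintype.card_fun, Fintype.card_fin, Fintype.card_fin,
      nsmul_eq_mul, Nat.cast_pow, clusterCost, Real.exp_neg, Real.exp_add, Real.exp_nat_mul,
      Real.exp_log hK0, Real.exp_log hn0, mul_inv, mul_inv_cancel_left₀ (by positivity)]
  rw [Finset.sum_congr rfl hterm, Finset.sum_const, Nat.card_Icc, Nat.add_sub_cancel, nsmul_eq_mul]
  exact mul_inv_le_one

variable {n : ℕ} {Ω : Type*} [MeasurableSpace Ω] {μ : Measure Ω}
  [IsProbabilityMeasure μ] {A : Ω → Matrix (Fin n) (Fin n) ℝ} {P : Matrix (Fin n) (Fin n) ℝ}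

namespace IsBernoulliNetwork

theorem measureReal_not_noiseControlled_le (hA : IsBernoulliNetwork μ A P) (hP : P.IsSymm)
    {κ : Type} [Fintype κ] [DecidableEq κ] (c : Fin n → κ) (J : Finset (Fin n × κ)) {x₁ x₂ : ℝ}
    (hx₁ : 0 ≤ x₁) (hx₂ : 0 ≤ x₂) :
    μ.real {ω | ¬NoiseControlled c J P (A ω - P) x₁ x₂} ≤
      Real.exp (-x₁) + Real.exp (12 * J.card - x₂) := by
  let far (W : Matrix (Fin n) (Fin n) ℝ) (x : ℝ) : Set Ω :=
    {ω | √(frobSq W) * √x < frobInner (A ω - P) W}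
  have hsub : {ω | ¬NoiseControlled c J P (A ω - P) x₁ x₂} ⊆ far (nearest c J P - P) x₁ ∪
      ⋃ z ∈ latticeNet J, ⋃ z' ∈ latticeNet J, far (latticeOuter c J z z') x₂ := by
    intro ω hω
    by_contra h
    simp only [far, Set.mem_union, Set.mem_iUnion, Set.mem_ofPred_eq, exists_prop, not_or,
      not_exists, not_and, not_lt] at h
    exact hω ⟨h.1, h.2⟩
  have hlattice : μ.real (⋃ z ∈ latticeNet J, ⋃ z' ∈ latticeNet J,
      far (latticeOuter c J z z') x₂) ≤ Real.exp (12 * J.card - x₂) := by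
    calc _ ≤ ∑ _z ∈ latticeNet J, ∑ _z' ∈ latticeNet J, Real.exp (-x₂) :=
          (measureReal_biUnion_finset_le _ _).trans (Finset.sum_le_sum fun _ _ =>
            (measureReal_biUnion_finset_le _ _).trans (Finset.sum_le_sum fun _ _ =>
              hA.measureReal_lt_frobInner_le hP _ hx₂))
      _ = (latticeNet J).card * ((latticeNet J).card * Real.exp (-x₂)) := by
          simp only [Finset.sum_const, nsmul_eq_mul]
      _ ≤ Real.exp (6 * J.card) * (Real.exp (6 * J.card) * Real.exp (-x₂)) := by
          have hcard := card_latticeNet_le J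
          gcongr
      _ = Real.exp (12 * J.card - x₂) := by
          rw [← Real.exp_add, ← Real.exp_add]
          ring_nf
  exact (measureReal_mono hsub).trans ((measureReal_union_le _ _).trans
    (add_le_add (hA.measureReal_lt_frobInner_le hP _ hx₁) hlattice))

variable {K : ℕ} {t : ℝ}

theorem measureReal_not_noiseControlledAt_le (hA : IsBernoulliNetwork μ A P) (hP : P.IsSymm)
    (a : PenaltyKind) (ht : 0 ≤ t) (c : Fin n → Fin K) (J : Finset (Fin n × Fin K)) :
    μ.real {ω | ¬NoiseControlledAt a t c J P (A ω - P)} ≤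
      Real.exp (-t) * Real.exp (-clusterCost n K) *
        (Real.exp (-(2 * suppCost a c J + 2 * sizeCost a c)) +
          Real.exp (-(3 * suppCost a c J + 2 * sizeCost a c))) := by
  refine (hA.measureReal_not_noiseControlled_le hP c J
    (deviationLevel_nonneg a zero_le_two ht c J)
    (add_nonneg (deviationLevel_nonneg a zero_le_three ht c J) (by positivity))).trans ?_
  rw [mul_add, ← Real.exp_add, ← Real.exp_add, ← Real.exp_add, deviationLevel, deviationLevel]
  have hcluster := clusterCost_nonneg n K
  gcongr <;> linarith

theorem measureReal_biUnion_reducedSupps_le (hA : IsBernoulliNetwork μ A P) (hP : P.IsSymm)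
    (a : PenaltyKind) (ht : 0 ≤ t) {c : Fin n → Fin K} (hc : Function.Surjective c) :
    μ.real (⋃ J ∈ reducedSupps c, {ω | ¬NoiseControlledAt a t c J P (A ω - P)}) ≤
      3 * Real.exp (-t) * Real.exp (-clusterCost n K) := by
  refine (measureReal_biUnion_finset_le _ _).trans ((Finset.sum_le_sum fun J _ =>
    hA.measureReal_not_noiseControlledAt_le hP a ht c J).trans ?_)
  rw [← Finset.mul_sum, Finset.sum_add_distrib, mul_assoc 3, mul_comm 3]
  gcongr
  exact (add_le_add (sum_exp_neg_cost_le a hc le_rfl)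
    (sum_exp_neg_cost_le a hc (by norm_num))).trans inv_one_sub_exp_add_le_three

theorem exists_forall_noiseControlledAt (hA : IsBernoulliNetwork μ A P) (hP : P.IsSymm)
    (hn : 1 ≤ n) (a : PenaltyKind) (ht : 0 ≤ t) :
    ∃ B : Set Ω, μ.real B ≤ 3 * Real.exp (-t) ∧ ∀ ω ∉ B, ∀ (K : ℕ) (c : Fin n → Fin K),
      Function.Surjective c → ∀ J ∈ reducedSupps c, NoiseControlledAt a t c J P (A ω - P) := by
  classical
  let bad (K : ℕ) (c : Fin n → Fin K) : Set Ω :=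
    ⋃ J ∈ reducedSupps c, {ω | ¬NoiseControlledAt a t c J P (A ω - P)}
  refine ⟨⋃ K ∈ Finset.Icc 1 n,
    ⋃ c ∈ (Finset.univ.filter Function.Surjective : Finset (Fin n → Fin K)), bad K c, ?_, ?_⟩
  · calc _ ≤ ∑ K ∈ Finset.Icc 1 n, ∑ c : Fin n → Fin K with Function.Surjective c,
            3 * Real.exp (-t) * Real.exp (-clusterCost n K) :=
          (measureReal_biUnion_finset_le _ _).trans (Finset.sum_le_sum fun K _ =>
            (measureReal_biUnion_finset_le _ _).trans (Finset.sum_le_sum fun c hc =>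
              hA.measureReal_biUnion_reducedSupps_le hP a ht (Finset.mem_filter.1 hc).2))
      _ ≤ ∑ K ∈ Finset.Icc 1 n, ∑ _c : Fin n → Fin K,
            3 * Real.exp (-t) * Real.exp (-clusterCost n K) :=
          Finset.sum_le_sum fun K _ => Finset.sum_le_sum_of_subset_of_nonneg
            (Finset.filter_subset _ _) fun _ _ _ => by positivity
      _ ≤ 3 * Real.exp (-t) := by
          simp only [← Finset.mul_sum]
          exact mul_le_of_le_one_right (by positivity) (sum_exp_neg_clusterCost_le_one n)
  · intro ω hω K c hc J hJ
    by_contra h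
    have hK1 : 1 ≤ K := (Nat.zero_le _).trans_lt (c ⟨0, hn⟩).2
    have hKn : K ≤ n := by simpa using Fintype.card_le_of_surjective c hc
    exact hω (Set.mem_biUnion (Finset.mem_coe.2 (Finset.mem_Icc.2 ⟨hK1, hKn⟩))
      (Set.mem_biUnion (Finset.mem_coe.2 (Finset.mem_filter.2 ⟨Finset.mem_univ c, hc⟩))
        (Set.mem_biUnion hJ h)))

theorem measureReal_lt_frobSq_le {α₁ α₂ : ℝ} {a : PenaltyKind} {s₀ : Feasible n}
    {sol : Ω → Feasible n} (hA : IsBernoulliNetwork μ A s₀.estimator)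
    (hsymm : s₀.estimator.IsSymm) (hn : 1 ≤ n)
    (hsol : ∀ ω, objective a (betaOne 420 64 α₁ α₂) (betaTwo 64 α₁ α₂) (A ω) (sol ω) ≤
      objective a (betaOne 420 64 α₁ α₂) (betaTwo 64 α₁ α₂) (A ω) s₀)
    (hα₁ : 0 < α₁) (hα₂ : 0 < α₂) (hα : α₁ + 8 * α₂ < 1) (ht : 0 ≤ t) :
    μ.real {ω | hZero α₁ α₂ * pen a (betaOne 420 64 α₁ α₂) (betaTwo 64 α₁ α₂) s₀.c s₀.J +
        cTilde 64 α₁ α₂ * t < frobSq ((sol ω).estimator - s₀.estimator)} ≤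
      3 * Real.exp (-t) := by
  obtain ⟨B, hB, hcontrolled⟩ := hA.exists_forall_noiseControlledAt hsymm hn a ht
  refine (measureReal_mono fun ω hω => ?_).trans hB
  by_contra hωB
  exact hω.not_ge (frobSq_sub_le_of_noiseControlled (hsol ω)
    (hcontrolled ω hωB _ _ (sol ω).surj _ (reducedSupp_mem_reducedSupps _ _))
    (hA.mem_Icc ω) (hA.mean_mem_Icc hsymm) ht hα₁ hα₂ hα)

end IsBernoulliNetwork

end UnionBound

section Tails

variable {Ω : Type*} [MeasurableSpace Ω] {μ : Measure Ω}

theorem integrable_and_integral_le_of_exp_tail [IsFiniteMeasure μ] {Y : Ω → ℝ}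
    (hY : AEMeasurable Y μ) (hY0 : 0 ≤ᵐ[μ] Y) {M : ℝ}
    (h : ∀ t : ℝ, 0 < t → μ.real {ω | t < Y ω} ≤ M * Real.exp (-t)) :
    Integrable Y μ ∧ ∫ ω, Y ω ∂μ ≤ M := by
  have hM : 0 ≤ M :=
    nonneg_of_mul_nonneg_left (measureReal_nonneg.trans (h 1 one_pos)) (Real.exp_pos _)
  have hlint : ∫⁻ ω, ENNReal.ofReal (Y ω) ∂μ ≤ ENNReal.ofReal M := by
    calc ∫⁻ ω, ENNReal.ofReal (Y ω) ∂μ = ∫⁻ t in Set.Ioi 0, μ {ω | t < Y ω} :=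
          lintegral_eq_lintegral_meas_lt μ hY0 hY
      _ ≤ ∫⁻ t in Set.Ioi 0, ENNReal.ofReal (M * Real.exp (-t)) :=
          setLIntegral_mono' measurableSet_Ioi fun t ht =>
            (ofReal_measureReal (μ := μ)).symm.trans_le (ENNReal.ofReal_le_ofReal (h t ht))
      _ = ENNReal.ofReal M := by
          rw [← ofReal_integral_eq_lintegral_ofReal ((integrableOn_exp_neg_Ioi 0).const_mul M)
            (ae_of_all _ fun t => by positivity), integral_const_mul, integral_exp_neg_Ioi_zero,
            mul_one]
  refine ⟨⟨hY.aestronglyMeasurable, ?_⟩, ?_⟩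
  · exact (hasFiniteIntegral_iff_ofReal hY0).2 (hlint.trans_lt ENNReal.ofReal_lt_top)
  · rw [integral_eq_lintegral_of_nonneg_ae hY0 hY.aestronglyMeasurable]
    exact ENNReal.toReal_le_of_le_ofReal hM hlint

theorem integrable_and_integral_le_of_shifted_exp_tail [IsProbabilityMeasure μ] {X : Ω → ℝ}
    (hX : AEMeasurable X μ) (hX0 : ∀ ω, 0 ≤ X ω) {q C M : ℝ} (hC : 0 < C)
    (h : ∀ t : ℝ, 0 < t → μ.real {ω | q + C * t < X ω} ≤ M * Real.exp (-t)) :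
    Integrable X μ ∧ ∫ ω, X ω ∂μ ≤ q + C * M := by
  let Y (ω : Ω) : ℝ := max ((X ω - q) / C) 0
  have hXY (ω : Ω) : X ω ≤ q + C * Y ω := by
    rw [← sub_le_iff_le_add', mul_comm, ← div_le_iff₀ hC]
    exact le_max_left _ _
  have hYtail (t : ℝ) (ht : 0 < t) : μ.real {ω | t < Y ω} ≤ M * Real.exp (-t) := by
    refine (measureReal_mono (Set.ofPred_subset_ofPred.2 fun ω hω => ?_)).trans (h t ht)
    have hlt := (lt_max_iff.1 hω).resolve_right ht.not_gt
    rwa [lt_div_iff₀ hC, mul_comm, lt_sub_iff_add_lt'] at hlt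
  obtain ⟨hYint, hYle⟩ := integrable_and_integral_le_of_exp_tail (Y := Y)
    (((hX.sub_const q).div_const C).max aemeasurable_const)
    (ae_of_all μ fun ω => le_max_right _ _) hYtail
  have hbound : Integrable (fun ω => q + C * Y ω) μ :=
    (integrable_const q).add (hYint.const_mul C)
  have hXint : Integrable X μ := hbound.mono' hX.aestronglyMeasurable
    (ae_of_all μ fun ω => (Real.norm_of_nonneg (hX0 ω)).trans_le (hXY ω))
  refine ⟨hXint, ?_⟩
  calc ∫ ω, X ω ∂μ ≤ ∫ ω, (q + C * Y ω) ∂μ := integral_mono hXint hbound hXY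
    _ = q + C * ∫ ω, Y ω ∂μ := by
        rw [integral_add (integrable_const q) (hYint.const_mul C), integral_const_mul,
          integral_const, probReal_univ, one_smul]
    _ ≤ q + C * M := by gcongr

theorem one_sub_measureReal_compl_le [IsProbabilityMeasure μ] (s : Set Ω) :
    1 - μ.real sᶜ ≤ μ.real s := by
  rw [sub_le_iff_le_add, ← probReal_univ (μ := μ), ← Set.union_compl_self s]
  exact measureReal_union_le s sᶜ

end Tails

section Rate

variable {n K : ℕ} {c : Fin n → Fin K}

theorem sum_commSize (c : Fin n → Fin K) : ∑ k, (commSize c k : ℝ) = n := by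
  simpa [commSize] using sum_rearranged c fun _ => 1

theorem suppCost_separable_le_nonseparable (c : Fin n → Fin K) (J : Finset (Fin n × Fin K)) :
    suppCost .separable c J ≤ suppCost .nonseparable c J := by
  have hsize : ∑ b : Fin K × Fin K, (commSize c b.1 : ℝ) = n * K := by
    rw [Fintype.sum_prod_type]
    simp only [Finset.sum_const, Finset.card_univ, Fintype.card_fin, nsmul_eq_mul]
    rw [← Finset.mul_sum, sum_commSize, mul_comm]
  have hcost := sum_subsetCost_le Finset.univ
    (N := fun b : Fin K × Fin K => (commSize c b.1 : ℝ))
    (j := fun b => ((suppSet c J b.1 b.2).card : ℝ)) (fun b _ => Nat.cast_nonneg _)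
    fun b _ => card_suppSet_le c J b.1 b.2
  rwa [hsize, Fintype.sum_prod_type, Fintype.sum_prod_type, sum_card_suppSet] at hcost

theorem sizeCost_separable_le (hn : 8 ≤ n) (hc : Function.Surjective c)
    (hK : (K : ℝ) ≤ √(n / Real.log n)) :
    sizeCost .separable c ≤ 2 * (n * Real.log K) + Real.log n := by
  have hn8 : (8 : ℝ) ≤ n := Nat.ofNat_le_cast.2 hn
  have hlog : 0 < Real.log n := Real.log_pos (by linarith)
  have hlogK : 0 ≤ n * Real.log K := mul_nonneg n.cast_nonneg (Real.log_natCast_nonneg K)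
  have hsize (k : Fin K) : Real.log (commSize c k) ≤ Real.log n :=
    Real.log_le_log (Nat.cast_pos.2 (commSize_pos hc k)) ((Finset.single_le_sum
      (f := fun k => (commSize c k : ℝ)) (fun _ _ => Nat.cast_nonneg _)
      (Finset.mem_univ k)).trans_eq (sum_commSize c))
  have hsq : sizeCost .separable c ≤ (K : ℝ) ^ 2 * Real.log n := by
    rw [sq, mul_assoc]
    refine mul_le_mul_of_nonneg_left ?_ K.cast_nonneg
    simpa using Finset.sum_le_sum fun k (_ : k ∈ Finset.univ) => hsize k
  rcases Nat.lt_or_ge K 2 with hK2 | hK2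
  · have hK1 : (K : ℝ) ^ 2 ≤ 1 :=
      pow_le_one₀ K.cast_nonneg (Nat.cast_le_one.2 (Nat.lt_succ_iff.1 hK2))
    linarith [mul_le_mul_of_nonneg_right hK1 hlog.le]
  · have hKn : (K : ℝ) ^ 2 * Real.log n ≤ n := by
      rw [← le_div_iff₀ hlog]
      exact (Real.le_sqrt K.cast_nonneg (by positivity)).1 hK
    have hhalf : 1 / 2 ≤ Real.log K := by
      have hmono : Real.log 2 ≤ Real.log K := Real.log_le_log two_pos (Nat.ofNat_le_cast.2 hK2)
      linarith [Real.log_two_gt_d9]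
    linarith [mul_le_mul_of_nonneg_left hhalf n.cast_nonneg]

theorem rate_eq (c : Fin n → Fin K) (J : Finset (Fin n × Fin K)) :
    rate J = suppCost .nonseparable c J + clusterCost n K := by
  rw [rate, suppCost, subsetCost, clusterCost]
  ring

theorem log_le_clusterCost (n K : ℕ) : Real.log n ≤ clusterCost n K :=
  le_add_of_nonneg_left (mul_nonneg n.cast_nonneg (Real.log_natCast_nonneg K))

variable {β₁ β₂ : ℝ}

theorem mul_rate_le_pen_nonseparable {β : ℝ} (hβ₁ : β ≤ β₁) (hβ₂ : β ≤ β₂) (hβ : 0 ≤ β)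
    (c : Fin n → Fin K) (J : Finset (Fin n × Fin K)) :
    β * rate J ≤ pen .nonseparable β₁ β₂ c J := by
  have hsupp : 0 ≤ suppCost .nonseparable c J :=
    suppCost_nonneg .nonseparable c J
  rw [rate_eq c, pen_eq, mul_add]
  refine add_le_add (mul_le_mul_of_nonneg_right hβ₁ hsupp) (mul_le_mul hβ₂ ?_
    (clusterCost_nonneg n K) (hβ.trans hβ₂))
  exact le_add_of_nonneg_left (sizeCost_nonneg .nonseparable c)

theorem pen_le_mul_rate {a : PenaltyKind} {J : Finset (Fin n × Fin K)} (hβ₁ : 0 ≤ β₁)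
    (hβ₂ : 0 ≤ β₂) (hsupp : suppCost a c J ≤ suppCost .nonseparable c J)
    (hsize : sizeCost a c ≤ 2 * clusterCost n K) :
    pen a β₁ β₂ c J ≤ (β₁ + 3 * β₂) * rate J := by
  have hcluster := clusterCost_nonneg n K
  have hsupp₀ : 0 ≤ suppCost .nonseparable c J :=
    suppCost_nonneg .nonseparable c J
  calc pen a β₁ β₂ c J = β₁ * suppCost a c J + β₂ * (sizeCost a c + clusterCost n K) :=
        pen_eq a β₁ β₂ c J
    _ ≤ β₁ * suppCost .nonseparable c J + β₂ * (2 * clusterCost n K + clusterCost n K) := by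
        gcongr
    _ ≤ (β₁ + 3 * β₂) * rate J := by
        rw [rate_eq c]
        linarith [mul_nonneg hβ₁ hcluster, mul_nonneg hβ₂ hsupp₀]

theorem exists_penalty_rate_bounds (hβ₁ : 0 < β₁) (hβ₂ : 0 < β₂) :
    ∃ κ : ℝ, 0 < κ ∧ ∀ (n K : ℕ) (c : Fin n → Fin K), Function.Surjective c →
      ∀ J : Finset (Fin n × Fin K),
        (κ⁻¹ * rate J ≤ pen .nonseparable β₁ β₂ c J ∧
          pen .nonseparable β₁ β₂ c J ≤ κ * rate J) ∧
        (8 ≤ n → (K : ℝ) ≤ √((n : ℝ) / Real.log (n : ℝ)) →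
          pen .separable β₁ β₂ c J ≤ κ * rate J) := by
  set κ := β₁ + 3 * β₂ + β₁⁻¹ + β₂⁻¹
  have hβ₁_inv : 0 < β₁⁻¹ := inv_pos.2 hβ₁
  have hβ₂_inv : 0 < β₂⁻¹ := inv_pos.2 hβ₂
  have hκ : 0 < κ := by positivity
  refine ⟨κ, hκ, fun n K c hc J => ?_⟩
  have hrate : (β₁ + 3 * β₂) * rate J ≤ κ * rate J := by
    refine mul_le_mul_of_nonneg_right (by linarith) ?_
    rw [rate_eq c]
    exact add_nonneg (suppCost_nonneg .nonseparable c J)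
      (clusterCost_nonneg n K)
  refine ⟨⟨?_, ?_⟩, fun hn hK => ?_⟩
  · exact mul_rate_le_pen_nonseparable (inv_le_of_inv_le₀ hβ₁ (by linarith))
      (inv_le_of_inv_le₀ hβ₂ (by linarith)) (inv_nonneg.2 hκ.le) c J
  · refine (pen_le_mul_rate hβ₁.le hβ₂.le le_rfl ?_).trans hrate
    exact mul_le_mul_of_nonneg_left (log_le_clusterCost n K) zero_le_two
  · refine (pen_le_mul_rate hβ₁.le hβ₂.le (suppCost_separable_le_nonseparable c J) ?_).trans hrate
    have hlog := Real.log_natCast_nonneg n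
    rw [clusterCost]
    linarith [sizeCost_separable_le hn hc hK]

end Rate

section Constants

variable {C₁ C₂ α₁ α₂ : ℝ}

theorem betaOne_pos (hC₁ : 0 < C₁) (hC₂ : 0 < C₂) (hα₁ : 0 < α₁) (hα₂ : 0 < α₂) :
    0 < betaOne C₁ C₂ α₁ α₂ := by
  rw [betaOne]
  positivity

theorem betaTwo_pos (hC₂ : 0 < C₂) (hα₁ : 0 < α₁) (hα₂ : 0 < α₂) : 0 < betaTwo C₂ α₁ α₂ := by
  rw [betaTwo]
  positivity

theorem cTilde_pos (hC₂ : 0 < C₂) (hα₁ : 0 < α₁) (hα₂ : 0 < α₂) (hα : α₁ + 8 * α₂ < 1) :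
    0 < cTilde C₂ α₁ α₂ := by
  have hH : 0 < hZero α₁ α₂ := inv_pos.2 (by linarith)
  rw [cTilde]
  positivity

end Constants

theorem aemeasurable_frobSq_sub {m m' : Type} [Fintype m] [Fintype m'] {Ω : Type*}
    [MeasurableSpace Ω] {μ : Measure Ω} {T : Ω → Matrix m m' ℝ} (P : Matrix m m' ℝ)
    (hT : ∀ i j, AEMeasurable (fun ω => T ω i j) μ) :
    AEMeasurable (fun ω => frobSq (T ω - P)) μ := by
  simp only [frobSq, Matrix.sub_apply]
  exact Finset.aemeasurable_fun_sum _ fun i _ => Finset.aemeasurable_fun_sum _ fun j _ =>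
    ((hT i j).sub_const _).pow_const 2

end

end SPABM

theorem theorem1_general :
    ∃ C₁ C₂ : ℝ, 0 < C₁ ∧ 0 < C₂ ∧ ∀ α₁ α₂ : ℝ, 0 < α₁ → 0 < α₂ → α₁ + 8 * α₂ < 1 →
      (∀ (a : SPABM.PenaltyKind) (n : ℕ), 1 ≤ n →
        ∀ s₀ : SPABM.Feasible n, s₀.estimator.IsSymm →
        ∀ (Ω : Type*) [MeasurableSpace Ω] (μ : MeasureTheory.Measure Ω)
          [MeasureTheory.IsProbabilityMeasure μ] (A : Ω → Matrix (Fin n) (Fin n) ℝ),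
          SPABM.IsBernoulliNetwork μ A s₀.estimator →
        ∀ sol : Ω → SPABM.Feasible n,
          (∀ ω, SPABM.objective a (SPABM.betaOne C₁ C₂ α₁ α₂) (SPABM.betaTwo C₂ α₁ α₂)
              (A ω) (sol ω) ≤
            SPABM.objective a (SPABM.betaOne C₁ C₂ α₁ α₂) (SPABM.betaTwo C₂ α₁ α₂) (A ω) s₀) →
          (∀ i j, AEMeasurable (fun ω => (sol ω).estimator i j) μ) →
          (∀ t : ℝ, 0 < t →
            1 - 3 * Real.exp (-t) ≤
              μ.real {ω | ((n : ℝ) ^ 2)⁻¹ *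
                  SPABM.frobSq ((sol ω).estimator - s₀.estimator) ≤
                ((n : ℝ) ^ 2)⁻¹ * (SPABM.hZero α₁ α₂ *
                  SPABM.pen a (SPABM.betaOne C₁ C₂ α₁ α₂) (SPABM.betaTwo C₂ α₁ α₂)
                    s₀.c s₀.J) +
                ((n : ℝ) ^ 2)⁻¹ * (SPABM.cTilde C₂ α₁ α₂ * t)}) ∧
          MeasureTheory.Integrable
            (fun ω => SPABM.frobSq ((sol ω).estimator - s₀.estimator)) μ ∧
          ((n : ℝ) ^ 2)⁻¹ *
              ∫ ω, SPABM.frobSq ((sol ω).estimator - s₀.estimator) ∂μ ≤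
            ((n : ℝ) ^ 2)⁻¹ * (SPABM.hZero α₁ α₂ *
              SPABM.pen a (SPABM.betaOne C₁ C₂ α₁ α₂) (SPABM.betaTwo C₂ α₁ α₂)
                s₀.c s₀.J) +
            3 * ((n : ℝ) ^ 2)⁻¹ * SPABM.cTilde C₂ α₁ α₂) ∧
      (∃ κ : ℝ, 0 < κ ∧
        ∀ (n : ℕ), 1 ≤ n → ∀ (K : ℕ) (c : Fin n → Fin K), Function.Surjective c →
        ∀ J : Finset (Fin n × Fin K),
          (κ⁻¹ * SPABM.rate J ≤
              SPABM.pen .nonseparable (SPABM.betaOne C₁ C₂ α₁ α₂) (SPABM.betaTwo C₂ α₁ α₂) c J ∧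
            SPABM.pen .nonseparable (SPABM.betaOne C₁ C₂ α₁ α₂) (SPABM.betaTwo C₂ α₁ α₂) c J ≤
              κ * SPABM.rate J) ∧
          (8 ≤ n → (K : ℝ) ≤ Real.sqrt ((n : ℝ) / Real.log (n : ℝ)) →
            SPABM.pen .separable (SPABM.betaOne C₁ C₂ α₁ α₂) (SPABM.betaTwo C₂ α₁ α₂) c J ≤
              κ * SPABM.rate J)) := by
  -- `64 = 8 ^ 2` comes from the factor `8` lost by the passage to lattice points; `420` makes the
  -- leading coefficient `2 (C₁ + C₂)` of `β₁` exceed the `64 * 15 + 2` charged per support entry.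
  refine ⟨420, 64, by norm_num, by norm_num, fun α₁ α₂ hα₁ hα₂ hα => ⟨?_, ?_⟩⟩
  · intro a n hn s₀ hsymm Ω _ μ _ A hA sol hsol hmeas
    have htail (t : ℝ) (ht : 0 < t) :=
      hA.measureReal_lt_frobSq_le hsymm hn hsol hα₁ hα₂ hα ht.le
    obtain ⟨hint, hmean⟩ := SPABM.integrable_and_integral_le_of_shifted_exp_tail
      (SPABM.aemeasurable_frobSq_sub s₀.estimator hmeas) (fun ω => SPABM.frobSq_nonneg _)
      (SPABM.cTilde_pos (by norm_num) hα₁ hα₂ hα) htail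
    have hn_sq : (0 : ℝ) < ((n : ℝ) ^ 2)⁻¹ := by positivity
    refine ⟨fun t ht => ?_, hint, ?_⟩
    · simp only [← mul_add, mul_le_mul_iff_right₀ hn_sq]
      refine le_trans ?_ (SPABM.one_sub_measureReal_compl_le _)
      simpa only [Set.compl_ofPred, not_le] using sub_le_sub_left (htail t ht) 1
    · exact (mul_le_mul_of_nonneg_left hmean hn_sq.le).trans_eq (by ring)
  · obtain ⟨κ, hκ, h⟩ := SPABM.exists_penalty_rate_bounds
      (SPABM.betaOne_pos (by norm_num : (0 : ℝ) < 420) (by norm_num : (0 : ℝ) < 64) hα₁ hα₂)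
      (SPABM.betaTwo_pos (by norm_num : (0 : ℝ) < 64) hα₁ hα₂)
    exact ⟨κ, hκ, fun n _ => h n⟩

theorem theorem1 :
    ∃ C₁ C₂ : ℝ, 0 < C₁ ∧ 0 < C₂ ∧ ∀ α₁ α₂ : ℝ, 0 < α₁ → 0 < α₂ → α₁ + 8 * α₂ < 1 →
      (∀ (a : SPABM.PenaltyKind) (n : ℕ), 1 ≤ n →
        ∀ (K : ℕ) (c : Fin n → Fin K), Function.Surjective c →
        ∀ Lam : Matrix (Fin n) (Fin K) ℝ, (∀ i l, Lam i l ∈ Set.Icc (0 : ℝ) 1) →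
        ∀ (Ω : Type*) [MeasurableSpace Ω] (μ : MeasureTheory.Measure Ω)
          [MeasureTheory.IsProbabilityMeasure μ] (A : Ω → Matrix (Fin n) (Fin n) ℝ),
          SPABM.IsBernoulliNetwork μ A (SPABM.probMatrix c Lam) →
        ∀ sol : Ω → SPABM.Feasible n,
          (∀ ω, SPABM.IsSolution a (SPABM.betaOne C₁ C₂ α₁ α₂) (SPABM.betaTwo C₂ α₁ α₂)
            (A ω) (sol ω)) →
          (∀ i j, AEMeasurable (fun ω => (sol ω).estimator i j) μ) →
          (∀ t : ℝ, 0 < t →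
            1 - 3 * Real.exp (-t) ≤
              μ.real {ω | ((n : ℝ) ^ 2)⁻¹ *
                  SPABM.frobSq ((sol ω).estimator - SPABM.probMatrix c Lam) ≤
                ((n : ℝ) ^ 2)⁻¹ * (SPABM.hZero α₁ α₂ *
                  SPABM.pen a (SPABM.betaOne C₁ C₂ α₁ α₂) (SPABM.betaTwo C₂ α₁ α₂)
                    c (SPABM.trueSupp Lam)) +
                ((n : ℝ) ^ 2)⁻¹ * (SPABM.cTilde C₂ α₁ α₂ * t)}) ∧
          MeasureTheory.Integrable
            (fun ω => SPABM.frobSq ((sol ω).estimator - SPABM.probMatrix c Lam)) μ ∧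
          ((n : ℝ) ^ 2)⁻¹ *
              ∫ ω, SPABM.frobSq ((sol ω).estimator - SPABM.probMatrix c Lam) ∂μ ≤
            ((n : ℝ) ^ 2)⁻¹ * (SPABM.hZero α₁ α₂ *
              SPABM.pen a (SPABM.betaOne C₁ C₂ α₁ α₂) (SPABM.betaTwo C₂ α₁ α₂)
                c (SPABM.trueSupp Lam)) +
            3 * ((n : ℝ) ^ 2)⁻¹ * SPABM.cTilde C₂ α₁ α₂) ∧
      (∃ κ : ℝ, 0 < κ ∧
        ∀ (n : ℕ), 1 ≤ n → ∀ (K : ℕ) (c : Fin n → Fin K), Function.Surjective c →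
        ∀ J : Finset (Fin n × Fin K),
          (κ⁻¹ * SPABM.rate J ≤
              SPABM.pen .nonseparable (SPABM.betaOne C₁ C₂ α₁ α₂) (SPABM.betaTwo C₂ α₁ α₂) c J ∧
            SPABM.pen .nonseparable (SPABM.betaOne C₁ C₂ α₁ α₂) (SPABM.betaTwo C₂ α₁ α₂) c J ≤
              κ * SPABM.rate J) ∧
          (8 ≤ n → (K : ℝ) ≤ Real.sqrt ((n : ℝ) / Real.log (n : ℝ)) →
            SPABM.pen .separable (SPABM.betaOne C₁ C₂ α₁ α₂) (SPABM.betaTwo C₂ α₁ α₂) c J ≤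
              κ * SPABM.rate J)) := by
  obtain ⟨C₁, C₂, hC₁, hC₂, h⟩ := theorem1_general
  exact ⟨C₁, C₂, hC₁, hC₂, fun α₁ α₂ hα₁ hα₂ hα => ⟨fun a n hn K c hc Lam _ Ω _ μ _ A hA sol hsol =>
    (h α₁ α₂ hα₁ hα₂ hα).1 a n hn (SPABM.trueFeasible c hc Lam)
      (Matrix.IsSymm.ext fun i j => mul_comm _ _) Ω μ A hA sol fun ω => hsol ω _,
    (h α₁ α₂ hα₁ hα₂ hα).2⟩⟩
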